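/- Let $n \ge 2$ and $d \ge 3$ be integers. In the balanced allocation scheme with double hashing, $n$ balls are placed one after the other into $n$ initially empty bins labelled $0, 1, \dots, n-1$. The $j$-th ball obtains two hash values: $f(j)$, uniform on $\{0, \dots, n-1\}$, and $g(j)$, uniform on the integers in $\{1, \dots, n-1\}$ that are relatively prime to $n$; all the hash values are independent. The $d$ choices of the $j$-th ball are the bins $f(j) + k\,g(j) \bmod n$ for $k = 0, 1, \dots, d-1$, and the ball is placed in a choice that currently holds the fewest balls, ties being broken uniformly at random and independently. Let $M_{n,d}$ be the maximum load, that is, the largest number of balls in a bin after all $n$ balls have been placed. Then the maximum load is $\frac{\log\log n}{\log d} + O(1)$ with high probability. Precisely: there is an absolute constant $C$ such that for every constant $d \ge 3$, $$\lim_{n \to \infty} \Pr\left( \left| M_{n,d} - \frac{\log \log n}{\log d} \right| \le C \right) = 1 .$$ -/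

import Mathlib

open Filter Topology

/-- The random data attached to one ball when there are `n` bins, labelled by `ZMod n`, and `d`
choices per ball: the two hash values, a position `f` in `ZMod n` and a stride `g`, which is a
residue relatively prime to `n`, together with a priority order `σ` of the `d` choices, which is
used to break ties. -/
def BallData (n d : ℕ) : Type :=
  ZMod n × (ZMod n)ˣ × Equiv.Perm (Fin d)

instance BallData.instMeasurableSpace (n d : ℕ) : MeasurableSpace (BallData n d) := ⊤

namespace BallData

variable {n d : ℕ}

/-- The hash value `f`. -/
def f (z : BallData n d) : ZMod n := z.1

/-- The stride `g`. -/
def g (z : BallData n d) : (ZMod n)ˣ := z.2.1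

/-- The priorities of the `d` choices; a smaller value wins a tie. -/
def σ (z : BallData n d) : Equiv.Perm (Fin d) := z.2.2

/-- The `k`-th choice of bin, `f + k g mod n`, for `k = 0, …, d - 1`. -/
def choice (z : BallData n d) (k : Fin d) : ZMod n :=
  z.f + (k : ℕ) * (z.g : ZMod n)

/-- The ball with data `z`, arriving when the loads are `x`, selects its `k`-th choice: that choice
is least loaded among the `d` choices and has the smallest priority value among those that are
least loaded. Exactly one `k` has this property when `d > 0`. -/
def Selects (x : ZMod n → ℕ) (z : BallData n d) (k : Fin d) : Prop :=
  ∀ l : Fin d, x (z.choice k) < x (z.choice l) ∨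
    (x (z.choice k) = x (z.choice l) ∧ z.σ k ≤ z.σ l)

end BallData

open Classical in
/-- The loads of the bins after the ball with data `z` is placed when the loads are `x`. -/
noncomputable def placeBall {n d : ℕ} (x : ZMod n → ℕ) (z : BallData n d) : ZMod n → ℕ :=
  fun b => if ∃ k : Fin d, z.Selects x k ∧ z.choice k = b then x b + 1 else x b

/-- The loads of the `n` bins after `m` balls with data `ω 0, ω 1, …, ω (m - 1)` are placed one
after the other into initially empty bins. -/
noncomputable def finalLoads {n d m : ℕ} (ω : Fin m → BallData n d) : ZMod n → ℕ :=
  (List.ofFn ω).foldl placeBall (fun _ => 0)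

/-- The largest number of balls in a bin after all `m` balls are placed. -/
noncomputable def maxLoad {n d m : ℕ} (ω : Fin m → BallData n d) : ℕ :=
  ⨆ b : ZMod n, finalLoads ω b

/-- The law of the data of `m` balls: all of `f`, `g`, `σ`, for all balls, are independent and
uniform, that is, the law is uniform on the finite set of all possible data (for `n ≥ 1`). -/
noncomputable def ballsLaw (n d m : ℕ) : MeasureTheory.Measure (Fin m → BallData n d) :=
  ProbabilityTheory.uniformOn Set.univ

/-! Write p_i for the probability that a given bin holds at least i balls (`tailProb`) and q_i for
the probability that all d choices of a further ball do (`allProb`). If q_i were p_i^d, then p_{i+1}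
would be about p_i^d, a doubly exponential decay that reaches 1/n after log log n / log d + O(1)
levels. The work is to prove |q_i - p_i^d| = O_d(1/φ(n)) (`abs_allProb_sub_le`).

Resample one ball and keep all later ones. The set D of bins whose loads may differ grows like a
branching process: a ball meets D with probability at most d|D|/n and then adds at most d bins, so
E|D| stays O_d(1) over n balls. Covariances telescope over the resampled ball
(`abs_cov_avgStep_pow_le`), and two distinct choices of a random ball are close enough to
independent (`BallData.expect_choice_mul_choice_le`).

Upper bound: p_{i+1} ≤ p_i^d + error brings n p_i down to O_d(log n), since n/φ(n) = O(log n); a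
union bound then excludes the next level (`avgStep_pow_someInd_succ_le`). Lower bound: levels are
built in successive time windows (`pow_lowerExponent_le_tailProb`) while p_i ≥ n^(-1/4). The same
covariance estimate gives variance O_d(n) for the number of bins of height at least i, and
Chebyshev's inequality produces such a bin. -/

/-! ### Averaging operators and covariances along a random evolution. -/

section AverageStep

open scoped BigOperators

variable {X Y Z : Type*} [Fintype Z]

/-- The transition operator of the chain that moves from `x` to `a x z` for a uniform `z`. -/
noncomputable def avgStep (a : X → Z → X) : Module.End ℝ (X → ℝ) where
  toFun F x := 𝔼 z, F (a x z)
  map_add' F G := by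
    funext x
    simp [Finset.expect_add_distrib]
  map_smul' c F := by
    funext x
    simp [Finset.mul_expect]

theorem avgStep_apply (a : X → Z → X) (F : X → ℝ) (x : X) :
    avgStep a F x = 𝔼 z, F (a x z) := rfl

theorem avgStep_pow_succ_apply (a : X → Z → X) (m : ℕ) (F : X → ℝ) (x : X) :
    (avgStep a ^ (m + 1)) F x = 𝔼 z, (avgStep a ^ m) F (a x z) := by
  rw [pow_succ', Module.End.mul_apply, avgStep_apply]

/-- Separates the last move, whereas `avgStep_pow_succ_apply` separates the first. -/
theorem avgStep_pow_succ_apply' (a : X → Z → X) (m : ℕ) (F : X → ℝ) :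
    (avgStep a ^ (m + 1)) F = (avgStep a ^ m) (avgStep a F) := by
  rw [pow_succ, Module.End.mul_apply]

theorem avgStep_pow_mono (a : X → Z → X) (m : ℕ) {F G : X → ℝ} (h : ∀ x, F x ≤ G x) (x : X) :
    (avgStep a ^ m) F x ≤ (avgStep a ^ m) G x := by
  induction m generalizing x with
  | zero => simpa using h x
  | succ m ih =>
    rw [avgStep_pow_succ_apply, avgStep_pow_succ_apply]
    exact Finset.expect_le_expect fun z _ => ih _

theorem avgStep_pow_const [Nonempty Z] (a : X → Z → X) (m : ℕ) (c : ℝ) (x : X) :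
    (avgStep a ^ m) (fun _ => c) x = c := by
  induction m generalizing x with
  | zero => simp
  | succ m ih =>
    rw [avgStep_pow_succ_apply]
    simp [ih]

theorem avgStep_pow_nonneg [Nonempty Z] (a : X → Z → X) (m : ℕ) {F : X → ℝ} (h : ∀ x, 0 ≤ F x)
    (x : X) : 0 ≤ (avgStep a ^ m) F x := by
  simpa [avgStep_pow_const] using avgStep_pow_mono a m (F := fun _ => 0) h x

theorem avgStep_pow_le_one [Nonempty Z] (a : X → Z → X) (m : ℕ) {F : X → ℝ} (h : ∀ x, F x ≤ 1)
    (x : X) : (avgStep a ^ m) F x ≤ 1 := by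
  simpa [avgStep_pow_const] using avgStep_pow_mono a m (G := fun _ => 1) h x

theorem avgStep_pow_sum {ι : Type*} (a : X → Z → X) (m : ℕ) (s : Finset ι) (F : ι → X → ℝ)
    (x : X) :
    (avgStep a ^ m) (fun x => ∑ i ∈ s, F i x) x = ∑ i ∈ s, (avgStep a ^ m) (F i) x := by
  have : (fun x => ∑ i ∈ s, F i x) = ∑ i ∈ s, F i := by
    funext x
    simp
  rw [this, map_sum, Finset.sum_apply]

theorem avgStep_pow_expect {ι : Type*} (a : X → Z → X) (m : ℕ) (s : Finset ι) (F : ι → X → ℝ)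
    (x : X) :
    (avgStep a ^ m) (fun x => 𝔼 i ∈ s, F i x) x = 𝔼 i ∈ s, (avgStep a ^ m) (F i) x := by
  have : (fun x => 𝔼 i ∈ s, F i x) = (s.card : ℝ)⁻¹ • fun x => ∑ i ∈ s, F i x := by
    funext x
    simp [Finset.expect_eq_sum_div_card, div_eq_inv_mul]
  rw [this, map_smul, Pi.smul_apply, avgStep_pow_sum, Finset.expect_eq_sum_div_card, smul_eq_mul,
    div_eq_inv_mul]

theorem expect_foldl_ofFn (a : X → Z → X) (m : ℕ) (F : X → ℝ) (x : X) :
    𝔼 ω : Fin m → Z, F ((List.ofFn ω).foldl a x) = (avgStep a ^ m) F x := by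
  induction m generalizing x with
  | zero => simp
  | succ m ih =>
    rw [avgStep_pow_succ_apply]
    simp_rw [← ih]
    rw [← Fintype.expect_equiv (Fin.consEquiv fun _ => Z)
      (fun p : Z × (Fin m → Z) => F ((List.ofFn p.2).foldl a (a x p.1))) _
      (fun p => by simp [Fin.consEquiv]), ← Finset.univ_product_univ, Finset.expect_product]

/-- If the relation `r x x' y` is preserved by the joint evolution and `H y` bounds the difference
of `F` at related points, then the evolved `H` bounds the difference of the evolved `F`. -/
theorem abs_avgStep_pow_sub_le {a : X → Z → X} {b : Y → Z → Y} {r : X → X → Y → Prop}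
    (hr : ∀ x x' y z, r x x' y → r (a x z) (a x' z) (b y z)) {F : X → ℝ} {H : Y → ℝ}
    (hF : ∀ x x' y, r x x' y → |F x - F x'| ≤ H y) (m : ℕ) {x x' : X} {y : Y} (h : r x x' y) :
    |(avgStep a ^ m) F x - (avgStep a ^ m) F x'| ≤ (avgStep b ^ m) H y := by
  induction m generalizing x x' y with
  | zero => simpa using hF _ _ _ h
  | succ m ih =>
    simp only [avgStep_pow_succ_apply]
    rw [← Finset.expect_sub_distrib]
    refine (Finset.abs_expect_le _ _).trans ?_
    exact Finset.expect_le_expect fun z _ => ih (hr _ _ _ _ h)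

/-- Symmetrised by an independent copy, a covariance involves only differences, which a coupling can
control. -/
theorem expect_mul_sub_expect_mul_expect [Nonempty Z] (A B : Z → ℝ) :
    (𝔼 z, A z * B z) - (𝔼 z, A z) * 𝔼 z, B z
      = 1 / 2 * 𝔼 z, 𝔼 z', (A z - A z') * (B z - B z') := by
  have h : ∀ z z', (A z - A z') * (B z - B z')
      = A z * B z + A z' * B z' - (A z * B z' + A z' * B z) := fun z z' => by ring
  simp only [h, Finset.expect_sub_distrib, Finset.expect_add_distrib, ← Finset.mul_expect,
    ← Finset.expect_mul, Fintype.expect_const]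
  ring

/-- A bound for the covariance, after `m` steps, of two functions whose sensitivities are bounded
by `H` and `K`. -/
noncomputable def covBound (b : Y → Z → Y) (D : Z → Z → Y) (m : ℕ) (H K : Y → ℝ) : ℝ :=
  ∑ s ∈ Finset.range m,
    1 / 2 * 𝔼 z, 𝔼 z', (avgStep b ^ s) H (D z z') * (avgStep b ^ s) K (D z z')

theorem covBound_nonneg [Nonempty Z] (b : Y → Z → Y) (D : Z → Z → Y) (m : ℕ) {H K : Y → ℝ}
    (hH : ∀ y, 0 ≤ H y) (hK : ∀ y, 0 ≤ K y) : 0 ≤ covBound b D m H K := by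
  refine Finset.sum_nonneg fun s _ => mul_nonneg (by norm_num) ?_
  exact Finset.expect_nonneg fun z _ => Finset.expect_nonneg fun z' _ =>
    mul_nonneg (avgStep_pow_nonneg _ _ hH _) (avgStep_pow_nonneg _ _ hK _)

theorem covBound_sum_right {ι : Type*} (b : Y → Z → Y) (D : Z → Z → Y) (m : ℕ) (H : Y → ℝ)
    (s : Finset ι) (K : ι → Y → ℝ) :
    covBound b D m H (fun y => ∑ i ∈ s, K i y) = ∑ i ∈ s, covBound b D m H (K i) := by
  simp only [covBound]
  rw [Finset.sum_comm]
  refine Finset.sum_congr rfl fun t _ => ?_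
  rw [← Finset.mul_sum]
  simp only [avgStep_pow_sum, Finset.mul_sum, Finset.expect_sum_comm]

/-- Law of total covariance, conditioning on the first move: the mean of the conditional covariances
is the induction hypothesis, and the covariance of the conditional means is the new term s = m of
`covBound`, s being the number of moves after the resampled one. -/
theorem abs_cov_avgStep_pow_le [Nonempty Z] {a : X → Z → X} {b : Y → Z → Y}
    {r : X → X → Y → Prop} (hr : ∀ x x' y z, r x x' y → r (a x z) (a x' z) (b y z))
    {D : Z → Z → Y} (hD : ∀ x z z', r (a x z) (a x z') (D z z')) {F G : X → ℝ} {H K : Y → ℝ}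
    (hF : ∀ x x' y, r x x' y → |F x - F x'| ≤ H y)
    (hG : ∀ x x' y, r x x' y → |G x - G x'| ≤ K y) (m : ℕ) (x : X) :
    |(avgStep a ^ m) (F * G) x - (avgStep a ^ m) F x * (avgStep a ^ m) G x|
      ≤ covBound b D m H K := by
  induction m generalizing x with
  | zero => simp [covBound]
  | succ m ih =>
    have hsplit : (avgStep a ^ (m + 1)) (F * G) x
        - (avgStep a ^ (m + 1)) F x * (avgStep a ^ (m + 1)) G x
        = (𝔼 z, ((avgStep a ^ m) (F * G) (a x z)
            - (avgStep a ^ m) F (a x z) * (avgStep a ^ m) G (a x z)))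
          + 1 / 2 * 𝔼 z, 𝔼 z', ((avgStep a ^ m) F (a x z) - (avgStep a ^ m) F (a x z'))
            * ((avgStep a ^ m) G (a x z) - (avgStep a ^ m) G (a x z')) := by
      rw [← expect_mul_sub_expect_mul_expect, Finset.expect_sub_distrib]
      simp only [avgStep_pow_succ_apply]
      ring
    rw [hsplit, covBound, Finset.sum_range_succ]
    refine (abs_add_le _ _).trans (add_le_add ?_ ?_)
    · refine (Finset.abs_expect_le _ _).trans ?_
      exact Finset.expect_le Finset.univ_nonempty fun z _ => ih _
    · rw [abs_mul, abs_of_pos (by norm_num : (0 : ℝ) < 1 / 2)]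
      refine mul_le_mul_of_nonneg_left ?_ (by norm_num)
      refine (Finset.abs_expect_le _ _).trans (Finset.expect_le_expect fun z _ => ?_)
      refine (Finset.abs_expect_le _ _).trans (Finset.expect_le_expect fun z' _ => ?_)
      rw [abs_mul]
      have h1 := abs_avgStep_pow_sub_le hr hF m (hD x z z')
      have h2 := abs_avgStep_pow_sub_le hr hG m (hD x z z')
      exact mul_le_mul h1 h2 (abs_nonneg _) ((abs_nonneg _).trans h1)

theorem abs_prod_sub_prod_le_sum {ι : Type*} (s : Finset ι) {u v : ι → ℝ}
    (hu : ∀ i, u i ∈ Set.Icc (0 : ℝ) 1) (hv : ∀ i, v i ∈ Set.Icc (0 : ℝ) 1) :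
    |∏ i ∈ s, u i - ∏ i ∈ s, v i| ≤ ∑ i ∈ s, |u i - v i| := by
  classical
  induction s using Finset.induction_on with
  | empty => simp
  | insert j s hj ih =>
    rw [Finset.prod_insert hj, Finset.prod_insert hj, Finset.sum_insert hj]
    have h0 : 0 ≤ ∏ i ∈ s, u i := Finset.prod_nonneg fun i _ => (hu i).1
    have h1 : ∏ i ∈ s, u i ≤ 1 := Finset.prod_le_one (fun i _ => (hu i).1) fun i _ => (hu i).2
    have e : u j * ∏ i ∈ s, u i - v j * ∏ i ∈ s, v i
        = (u j - v j) * ∏ i ∈ s, u i + v j * (∏ i ∈ s, u i - ∏ i ∈ s, v i) := by ring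
    rw [e]
    refine (abs_add_le _ _).trans (add_le_add ?_ ?_)
    · rw [abs_mul, abs_of_nonneg h0]
      exact mul_le_of_le_one_right (abs_nonneg _) h1
    · rw [abs_mul, abs_of_nonneg (hv j).1]
      exact (mul_le_of_le_one_left (abs_nonneg _) (hv j).2).trans ih

/-- Factors are split off one at a time; the product of the others has sensitivity at most the sum
of theirs, so only covariance bounds of distinct pairs appear. -/
theorem abs_avgStep_pow_prod_sub_le [Nonempty Z] {ι : Type*} [DecidableEq ι] {a : X → Z → X}
    {b : Y → Z → Y} {r : X → X → Y → Prop}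
    (hr : ∀ x x' y z, r x x' y → r (a x z) (a x' z) (b y z))
    {D : Z → Z → Y} (hD : ∀ x z z', r (a x z) (a x z') (D z z')) {F : ι → X → ℝ} {H : ι → Y → ℝ}
    (hF01 : ∀ i x, F i x ∈ Set.Icc (0 : ℝ) 1) (hH : ∀ i y, 0 ≤ H i y)
    (hF : ∀ i x x' y, r x x' y → |F i x - F i x'| ≤ H i y) (m : ℕ) (x : X) (s : Finset ι) :
    |(avgStep a ^ m) (fun x => ∏ i ∈ s, F i x) x - ∏ i ∈ s, (avgStep a ^ m) (F i) x|
      ≤ ∑ i ∈ s, ∑ j ∈ s, if i = j then 0 else covBound b D m (H i) (H j) := by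
  have hpos : ∀ i j, 0 ≤ if i = j then 0 else covBound b D m (H i) (H j) := fun i j => by
    split_ifs
    · exact le_rfl
    · exact covBound_nonneg _ _ _ (hH i) (hH j)
  induction s using Finset.induction_on with
  | empty => simp [avgStep_pow_const]
  | insert j s hj ih =>
    have hprod : ∀ x x' y, r x x' y → |(∏ i ∈ s, F i x) - ∏ i ∈ s, F i x'| ≤ ∑ i ∈ s, H i y :=
      fun x x' y h => (abs_prod_sub_prod_le_sum s (fun i => hF01 i x) fun i => hF01 i x').trans
        (Finset.sum_le_sum fun i _ => hF i _ _ _ h)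
    have hcov := abs_cov_avgStep_pow_le hr hD (hF j) hprod m x
    rw [covBound_sum_right] at hcov
    have hmul : (fun x => ∏ i ∈ insert j s, F i x) = F j * fun x => ∏ i ∈ s, F i x := by
      funext x
      simp [Finset.prod_insert hj]
    rw [hmul, Finset.prod_insert hj]
    set P : X → ℝ := fun x => ∏ i ∈ s, F i x
    have e : (avgStep a ^ m) (F j * P) x
        - (avgStep a ^ m) (F j) x * ∏ i ∈ s, (avgStep a ^ m) (F i) x
        = ((avgStep a ^ m) (F j * P) x - (avgStep a ^ m) (F j) x * (avgStep a ^ m) P x)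
          + (avgStep a ^ m) (F j) x
            * ((avgStep a ^ m) P x - ∏ i ∈ s, (avgStep a ^ m) (F i) x) := by ring
    rw [e, Finset.sum_insert hj]
    refine (abs_add_le _ _).trans (add_le_add (hcov.trans ?_) ?_)
    · rw [Finset.sum_insert hj]
      refine le_add_of_nonneg_of_le (hpos j j) (Finset.sum_le_sum fun i hi => ?_)
      rw [if_neg]
      rintro rfl
      exact hj hi
    · rw [abs_mul, abs_of_nonneg (avgStep_pow_nonneg _ _ (fun x => (hF01 j x).1) _)]
      refine (mul_le_of_le_one_left (abs_nonneg _)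
        (avgStep_pow_le_one _ _ (fun x => (hF01 j x).2) _)).trans (ih.trans ?_)
      refine Finset.sum_le_sum fun i _ => ?_
      rw [Finset.sum_insert hj]
      exact le_add_of_nonneg_left (hpos i j)

end AverageStep

/-! ### A lower bound for the totient, and linear equations modulo n. -/

/-- The largest of k + 1 distinct integers ≥ 2 is at least k + 2, so its factor a/(a - 1) is at most
(k + 2)/(k + 1), and these telescope. -/
theorem prod_le_card_add_one_mul_prod_sub_one (s : Finset ℕ) (hs : ∀ p ∈ s, 2 ≤ p) :
    ∏ p ∈ s, p ≤ (s.card + 1) * ∏ p ∈ s, (p - 1) := by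
  induction s using Finset.induction_on_max with
  | empty => simp
  | insert a s hlt ih =>
    have ha : a ∉ s := fun h => lt_irrefl _ (hlt a h)
    have h2 : 2 ≤ a := hs a (Finset.mem_insert_self a s)
    have hcard : s.card + 2 ≤ a := by
      have hsub : s ⊆ Finset.Ico 2 a := fun p hp =>
        Finset.mem_Ico.2 ⟨hs p (Finset.mem_insert_of_mem hp), hlt p hp⟩
      have := Finset.card_le_card hsub
      rw [Nat.card_Ico] at this
      omega
    have ih' := ih fun p hp => hs p (Finset.mem_insert_of_mem hp)
    rw [Finset.prod_insert ha, Finset.prod_insert ha, Finset.card_insert_of_notMem ha]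
    obtain ⟨c, rfl⟩ := Nat.exists_eq_add_of_le hcard
    have e : s.card + 2 + c - 1 = s.card + 1 + c := by omega
    rw [e]
    calc (s.card + 2 + c) * ∏ p ∈ s, p
        ≤ (s.card + 2 + c) * ((s.card + 1) * ∏ p ∈ s, (p - 1)) := Nat.mul_le_mul_left _ ih'
      _ = ((s.card + 2 + c) * (s.card + 1)) * ∏ p ∈ s, (p - 1) := by ring
      _ ≤ ((s.card + 1 + 1) * (s.card + 1 + c)) * ∏ p ∈ s, (p - 1) :=
          Nat.mul_le_mul_right _ (by nlinarith)
      _ = (s.card + 1 + 1) * ((s.card + 1 + c) * ∏ p ∈ s, (p - 1)) := by ring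

theorem two_pow_card_primeFactors_le {n : ℕ} (hn : n ≠ 0) : 2 ^ n.primeFactors.card ≤ n :=
  calc 2 ^ n.primeFactors.card = ∏ _p ∈ n.primeFactors, 2 := by simp
    _ ≤ ∏ p ∈ n.primeFactors, p :=
        Finset.prod_le_prod' fun p hp => (Nat.prime_of_mem_primeFactors hp).two_le
    _ ≤ n := Nat.le_of_dvd (Nat.pos_of_ne_zero hn) (Nat.prod_primeFactors_dvd n)

theorem le_log_add_one_mul_totient {n : ℕ} (hn : n ≠ 0) :
    n ≤ (Nat.log 2 n + 1) * n.totient := by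
  have h1 := prod_le_card_add_one_mul_prod_sub_one n.primeFactors
    fun p hp => (Nat.prime_of_mem_primeFactors hp).two_le
  have h2 : n.primeFactors.card ≤ Nat.log 2 n :=
    Nat.le_log_of_pow_le one_lt_two (two_pow_card_primeFactors_le hn)
  have h3 := Nat.totient_mul_prod_primeFactors n
  have hpos : 0 < ∏ p ∈ n.primeFactors, (p - 1) := Finset.prod_pos fun p hp =>
    Nat.sub_pos_of_lt (Nat.prime_of_mem_primeFactors hp).one_lt
  refine Nat.le_of_mul_le_mul_right ?_ hpos
  calc n * ∏ p ∈ n.primeFactors, (p - 1) = n.totient * ∏ p ∈ n.primeFactors, p := h3.symm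
    _ ≤ n.totient * ((n.primeFactors.card + 1) * ∏ p ∈ n.primeFactors, (p - 1)) :=
        Nat.mul_le_mul_left _ h1
    _ ≤ n.totient * ((Nat.log 2 n + 1) * ∏ p ∈ n.primeFactors, (p - 1)) :=
        Nat.mul_le_mul_left _ (Nat.mul_le_mul_right _ (Nat.add_le_add_right h2 1))
    _ = (Nat.log 2 n + 1) * n.totient * ∏ p ∈ n.primeFactors, (p - 1) := by ring

/-- The remainder of m x modulo n is fixed, so x is determined by the quotient, which is less than
m. -/
theorem ZMod.card_nsmul_eq_le {n : ℕ} [NeZero n] {m : ℕ} (hm : 0 < m) (c : ZMod n) :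
    (Finset.univ.filter fun x : ZMod n => (m : ZMod n) * x = c).card ≤ m := by
  classical
  have hn : 0 < n := Nat.pos_of_ne_zero (NeZero.ne n)
  have hmod : ∀ x : ZMod n, (m : ZMod n) * x = c → (m * x.val) % n = c.val := fun x hx => by
    rw [← ZMod.val_natCast, Nat.cast_mul, ZMod.natCast_zmod_val, hx]
  refine (Finset.card_le_card_of_injOn (t := Finset.range m) (fun x => m * x.val / n)
    (fun x _ => ?_) fun x hx y hy hxy => ?_).trans_eq (Finset.card_range m)
  · rw [Finset.mem_coe, Finset.mem_range, Nat.div_lt_iff_lt_mul hn]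
    exact Nat.mul_lt_mul_of_pos_left (ZMod.val_lt x) hm
  · have hx' := hmod x (Finset.mem_filter.1 hx).2
    have hy' := hmod y (Finset.mem_filter.1 hy).2
    have h1 := Nat.div_add_mod (m * x.val) n
    have h2 := Nat.div_add_mod (m * y.val) n
    simp only at hxy
    rw [hxy, hx'] at h1
    rw [hy', h1] at h2
    exact ZMod.val_injective n (Nat.eq_of_mul_eq_mul_left hm h2)

/-! ### The joint law of two choices of a ball. -/

section Hashing

open scoped BigOperators

variable {n d : ℕ} [NeZero n]

noncomputable instance BallData.instFintype : Fintype (BallData n d) :=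
  inferInstanceAs (Fintype (ZMod n × (ZMod n)ˣ × Equiv.Perm (Fin d)))

instance BallData.instNonempty : Nonempty (BallData n d) :=
  inferInstanceAs (Nonempty (ZMod n × (ZMod n)ˣ × Equiv.Perm (Fin d)))

instance BallData.instMeasurableSingletonClass : MeasurableSingletonClass (BallData n d) :=
  ⟨fun _ => trivial⟩

theorem BallData.expect_eq (Φ : ZMod n → (ZMod n)ˣ → ℝ) :
    𝔼 z : BallData n d, Φ z.f z.g = 𝔼 g, 𝔼 f, Φ f g := by
  have h : 𝔼 z : BallData n d, Φ z.f z.g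
      = 𝔼 p : ZMod n × (ZMod n)ˣ × Equiv.Perm (Fin d), Φ p.1 p.2.1 := rfl
  rw [h, ← Finset.univ_product_univ, Finset.expect_product]
  simp only [← Finset.univ_product_univ, Finset.expect_product, Fintype.expect_const]
  exact Finset.expect_comm _ _ _

theorem BallData.expect_choice (φ : ZMod n → ℝ) (k : Fin d) :
    𝔼 z : BallData n d, φ (z.choice k) = 𝔼 v, φ v := by
  refine (BallData.expect_eq fun f g => φ (f + ((k : ℕ) : ZMod n) * (g : ZMod n))).trans ?_
  have h : ∀ g : (ZMod n)ˣ, 𝔼 f, φ (f + ((k : ℕ) : ZMod n) * (g : ZMod n)) = 𝔼 v, φ v := fun g =>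
    Fintype.expect_equiv (Equiv.addRight _) _ _ fun f => rfl
  simp only [h, Fintype.expect_const]

/-- Coprimality of the stride is dropped: the sum extends to all residues, each value being taken at
most m times. -/
theorem sum_units_le {m : ℕ} (hm : 0 < m) {ψ : ZMod n → ℝ} (hψ : ∀ v, 0 ≤ ψ v) (v : ZMod n) :
    ∑ g : (ZMod n)ˣ, ψ (v + m * (g : ZMod n)) ≤ m * ∑ w, ψ w := by
  classical
  calc ∑ g : (ZMod n)ˣ, ψ (v + m * (g : ZMod n))
      = ∑ x ∈ Finset.univ.image (fun g : (ZMod n)ˣ => (g : ZMod n)), ψ (v + m * x) :=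
        (Finset.sum_image (f := fun x => ψ (v + m * x)) fun a _ b _ h => Units.ext h).symm
    _ ≤ ∑ x : ZMod n, ψ (v + m * x) :=
        Finset.sum_le_sum_of_subset_of_nonneg (Finset.subset_univ _) fun _ _ _ => hψ _
    _ = ∑ w : ZMod n, ∑ x ∈ Finset.univ.filter (fun x : ZMod n => v + m * x = w),
          ψ (v + m * x) := (Finset.sum_fiberwise _ _ _).symm
    _ ≤ ∑ w : ZMod n, m * ψ w := by
        refine Finset.sum_le_sum fun w _ => ?_
        rw [Finset.sum_congr rfl fun x hx => by rw [(Finset.mem_filter.1 hx).2],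
          Finset.sum_const, nsmul_eq_mul]
        refine mul_le_mul_of_nonneg_right ?_ (hψ w)
        have : (Finset.univ.filter fun x : ZMod n => v + m * x = w)
            = Finset.univ.filter fun x : ZMod n => (m : ZMod n) * x = w - v :=
          Finset.filter_congr fun x _ => by rw [eq_sub_iff_add_eq, add_comm]
        rw [this]
        exact_mod_cast ZMod.card_nsmul_eq_le hm _
    _ = m * ∑ w, ψ w := by rw [Finset.mul_sum]

/-- Given the stride, the j-th choice v is uniform, and the k-th one is v + (k - j) g. -/
theorem BallData.expect_choice_mul_choice_le_of_lt {φ ψ : ZMod n → ℝ} (hφ : ∀ v, 0 ≤ φ v)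
    (hψ : ∀ v, 0 ≤ ψ v) {j k : Fin d} (hjk : j < k) :
    𝔼 z : BallData n d, φ (z.choice j) * ψ (z.choice k)
      ≤ ((k - j : ℕ) : ℝ) * (∑ v, φ v) * (∑ v, ψ v) / (n * n.totient) := by
  have hm : 0 < (k - j : ℕ) := Nat.sub_pos_of_lt hjk
  refine (BallData.expect_eq fun f g => φ (f + ((j : ℕ) : ZMod n) * (g : ZMod n)) *
    ψ (f + ((k : ℕ) : ZMod n) * (g : ZMod n))).trans_le ?_
  have h : ∀ g : (ZMod n)ˣ, 𝔼 f, φ (f + ((j : ℕ) : ZMod n) * (g : ZMod n)) *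
        ψ (f + ((k : ℕ) : ZMod n) * (g : ZMod n))
      = 𝔼 v, φ v * ψ (v + ((k - j : ℕ) : ZMod n) * (g : ZMod n)) := fun g =>
    Fintype.expect_equiv (Equiv.addRight _) _ _ fun f => by
      rw [Equiv.coe_addRight, Nat.cast_sub (Fin.le_def.1 hjk.le)]
      congr 2
      ring
  simp only [h]
  rw [Finset.expect_comm]
  simp only [Fintype.expect_eq_sum_div_card, ZMod.card, ZMod.card_units_eq_totient,
    ← Finset.sum_div]
  rw [div_div, mul_comm (n.totient : ℝ)]
  refine div_le_div_of_nonneg_right ?_ (by positivity)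
  simp only [← Finset.mul_sum]
  rw [mul_assoc, mul_left_comm, Finset.sum_mul]
  exact Finset.sum_le_sum fun v _ => mul_le_mul_of_nonneg_left (sum_units_le hm hψ v) (hφ v)

theorem BallData.expect_choice_mul_choice_le {φ ψ : ZMod n → ℝ} (hφ : ∀ v, 0 ≤ φ v)
    (hψ : ∀ v, 0 ≤ ψ v) {j k : Fin d} (hjk : j ≠ k) :
    𝔼 z : BallData n d, φ (z.choice j) * ψ (z.choice k)
      ≤ d * (∑ v, φ v) * (∑ v, ψ v) / (n * n.totient) := by
  have h1 : 0 ≤ ∑ v, φ v := Finset.sum_nonneg fun v _ => hφ v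
  have h2 : 0 ≤ ∑ v, ψ v := Finset.sum_nonneg fun v _ => hψ v
  have hd : ∀ a b : Fin d, (a - b : ℕ) ≤ d := fun a b => (Nat.sub_le _ _).trans a.2.le
  rcases lt_or_gt_of_ne hjk with h | h
  · refine (BallData.expect_choice_mul_choice_le_of_lt hφ hψ h).trans ?_
    gcongr
    exact hd k j
  · simp only [mul_comm (φ _)]
    refine (BallData.expect_choice_mul_choice_le_of_lt hψ hφ h).trans ?_
    rw [mul_right_comm]
    gcongr
    exact hd j k

end Hashing

/-! ### The effect of one ball: discrepancies, levels, translations. -/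

section Placement

open scoped BigOperators

variable {n d : ℕ}

theorem BallData.exists_selects (hd : 0 < d) (x : ZMod n → ℕ) (z : BallData n d) :
    ∃ k, z.Selects x k := by
  have : Nonempty (Fin d) := ⟨⟨0, hd⟩⟩
  obtain ⟨k, hk⟩ := Finite.exists_min fun k : Fin d => toLex (x (z.choice k), z.σ k)
  exact ⟨k, fun l => Prod.Lex.toLex_le_toLex.1 (hk l)⟩

theorem BallData.Selects.eq {x : ZMod n → ℕ} {z : BallData n d} {k l : Fin d}
    (hk : z.Selects x k) (hl : z.Selects x l) : k = l := by
  have h1 := hk l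
  have h2 := hl k
  refine z.σ.injective (le_antisymm ?_ ?_)
  · rcases h1 with h | h
    · rcases h2 with h' | h' <;> omega
    · exact h.2
  · rcases h2 with h | h
    · rcases h1 with h' | h' <;> omega
    · exact h.2

theorem BallData.Selects.le {x : ZMod n → ℕ} {z : BallData n d} {k : Fin d}
    (hk : z.Selects x k) (l : Fin d) : x (z.choice k) ≤ x (z.choice l) := by
  rcases hk l with h | h
  · exact h.le
  · exact h.1.le

theorem placeBall_eq_update {x : ZMod n → ℕ} {z : BallData n d} {k : Fin d}
    (hk : z.Selects x k) :
    placeBall x z = Function.update x (z.choice k) (x (z.choice k) + 1) := by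
  funext b
  by_cases hb : b = z.choice k
  · subst hb
    rw [Function.update_self, placeBall, if_pos ⟨k, hk, rfl⟩]
  · rw [Function.update_of_ne hb, placeBall, if_neg]
    rintro ⟨l, hl, rfl⟩
    exact hb (by rw [hl.eq hk])

theorem le_placeBall (x : ZMod n → ℕ) (z : BallData n d) (b : ZMod n) : x b ≤ placeBall x z b := by
  rw [placeBall]
  split_ifs <;> omega

theorem placeBall_of_forall_choice_ne (x : ZMod n → ℕ) {z : BallData n d} {b : ZMod n}
    (h : ∀ k, z.choice k ≠ b) : placeBall x z b = x b := by
  rw [placeBall, if_neg]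
  rintro ⟨k, _, hk⟩
  exact h k hk

theorem placeBall_congr {x x' : ZMod n → ℕ} {z : BallData n d} {b : ZMod n}
    (h : ∀ k, x (z.choice k) = x' (z.choice k)) (hb : x b = x' b) :
    placeBall x z b = placeBall x' z b := by
  have : ∀ k, z.Selects x k ↔ z.Selects x' k := fun k => by simp only [BallData.Selects, h]
  have e : (∃ k, z.Selects x k ∧ z.choice k = b) ↔ ∃ k, z.Selects x' k ∧ z.choice k = b :=
    exists_congr fun k => and_congr_left' (this k)
  simp only [placeBall, hb]
  split_ifs with h1 h2 h2
  · rfl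
  · exact absurd (e.1 h1) h2
  · exact absurd (e.2 h2) h1
  · rfl

/-- The set of the choices of a ball. -/
def BallData.choices (z : BallData n d) : Finset (ZMod n) :=
  Finset.univ.image z.choice

theorem BallData.choice_mem_choices (z : BallData n d) (k : Fin d) : z.choice k ∈ z.choices :=
  Finset.mem_image_of_mem _ (Finset.mem_univ k)

theorem BallData.card_choices_le (z : BallData n d) : z.choices.card ≤ d :=
  Finset.card_image_le.trans (by simp)

/-- The set of bins that a discrepancy on `D` may have reached once the ball `z` is placed. -/
def spread (D : Finset (ZMod n)) (z : BallData n d) : Finset (ZMod n) :=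
  if ∃ k, z.choice k ∈ D then D ∪ z.choices else D

/-- The loads `x` and `x'` agree outside `D`. -/
def AgreeOff (x x' : ZMod n → ℕ) (D : Finset (ZMod n)) : Prop :=
  ∀ b ∉ D, x b = x' b

/-- A ball with no choice in D sees equal loads and goes to the same bin; any other ball affects
only its own choices. -/
theorem AgreeOff.placeBall {x x' : ZMod n → ℕ} {D : Finset (ZMod n)} (h : AgreeOff x x' D)
    (z : BallData n d) : AgreeOff (placeBall x z) (placeBall x' z) (spread D z) := by
  intro b hb
  rw [spread] at hb
  split_ifs at hb with hD
  · rw [Finset.notMem_union] at hb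
    have hne : ∀ k, z.choice k ≠ b := fun k hk => hb.2 (hk ▸ z.choice_mem_choices k)
    rw [placeBall_of_forall_choice_ne x hne, placeBall_of_forall_choice_ne x' hne]
    exact h b hb.1
  · exact placeBall_congr (fun k => h _ fun hk => hD ⟨k, hk⟩) (h b hb)

theorem agreeOff_placeBall_placeBall (x : ZMod n → ℕ) (z z' : BallData n d) :
    AgreeOff (placeBall x z) (placeBall x z') (z.choices ∪ z'.choices) := by
  intro b hb
  rw [Finset.notMem_union] at hb
  have h : ∀ k, z.choice k ≠ b := fun k hk => hb.1 (hk ▸ z.choice_mem_choices k)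
  have h' : ∀ k, z'.choice k ≠ b := fun k hk => hb.2 (hk ▸ z'.choice_mem_choices k)
  rw [placeBall_of_forall_choice_ne x h, placeBall_of_forall_choice_ne x h']

/-- The indicator that bin `b` holds at least `i` balls. -/
noncomputable def loadInd (i : ℕ) (b : ZMod n) (x : ZMod n → ℕ) : ℝ :=
  if i ≤ x b then 1 else 0

theorem loadInd_mem_Icc (i : ℕ) (b : ZMod n) (x : ZMod n → ℕ) :
    loadInd i b x ∈ Set.Icc (0 : ℝ) 1 := by
  rw [loadInd]
  split_ifs <;> simp

theorem loadInd_zero (b : ZMod n) (x : ZMod n → ℕ) : loadInd 0 b x = 1 := by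
  simp [loadInd]

theorem loadInd_mono {i : ℕ} {b : ZMod n} {x y : ZMod n → ℕ} (h : x b ≤ y b) :
    loadInd i b x ≤ loadInd i b y := by
  rw [loadInd, loadInd]
  split_ifs
  · exact le_rfl
  · omega
  · exact zero_le_one
  · exact le_rfl

/-- The indicator of a set of bins at `b`, as a function of the set. -/
noncomputable def memInd (b : ZMod n) (D : Finset (ZMod n)) : ℝ :=
  if b ∈ D then 1 else 0

theorem memInd_nonneg (b : ZMod n) (D : Finset (ZMod n)) : 0 ≤ memInd b D := by
  rw [memInd]
  split_ifs <;> simp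

theorem AgreeOff.abs_loadInd_sub_le {x x' : ZMod n → ℕ} {D : Finset (ZMod n)}
    (h : AgreeOff x x' D) (i : ℕ) (b : ZMod n) :
    |loadInd i b x - loadInd i b x'| ≤ memInd b D := by
  by_cases hb : b ∈ D
  · rw [memInd, if_pos hb, loadInd, loadInd]
    split_ifs <;> norm_num
  · rw [loadInd, loadInd, h b hb, sub_self, abs_zero]
    exact memInd_nonneg b D

/-- The indicator that all the choices of `z` hold at least `i` balls. -/
noncomputable def allInd (i : ℕ) (z : BallData n d) (x : ZMod n → ℕ) : ℝ :=
  ∏ k, loadInd i (z.choice k) x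

theorem allInd_eq {x : ZMod n → ℕ} {z : BallData n d} {k : Fin d} (hk : z.Selects x k) (i : ℕ) :
    allInd i z x = loadInd i (z.choice k) x := by
  by_cases h : i ≤ x (z.choice k)
  · rw [loadInd, if_pos h, allInd]
    exact Finset.prod_eq_one fun l _ => if_pos (h.trans (hk.le l))
  · rw [loadInd, if_neg h, allInd]
    exact Finset.prod_eq_zero (Finset.mem_univ k) (if_neg h)

theorem allInd_zero (z : BallData n d) (x : ZMod n → ℕ) : allInd 0 z x = 1 := by
  simp [allInd, loadInd_zero]

theorem allInd_nonneg (i : ℕ) (z : BallData n d) (x : ZMod n → ℕ) : 0 ≤ allInd i z x :=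
  Finset.prod_nonneg fun _ _ => (loadInd_mem_Icc _ _ _).1

theorem allInd_mono {i : ℕ} {z : BallData n d} {x y : ZMod n → ℕ} (h : ∀ b, x b ≤ y b) :
    allInd i z x ≤ allInd i z y :=
  Finset.prod_le_prod (fun _ _ => (loadInd_mem_Icc _ _ _).1) fun _ _ => loadInd_mono (h _)

theorem card_spread_le (D : Finset (ZMod n)) (z : BallData n d) :
    ((spread D z).card : ℝ) ≤ D.card + d * ∑ k, memInd (z.choice k) D := by
  have h0 : 0 ≤ ∑ k, memInd (z.choice k) D := Finset.sum_nonneg fun _ _ => memInd_nonneg _ _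
  rw [spread]
  split_ifs with h
  · obtain ⟨k, hk⟩ := h
    have h1 : 1 ≤ ∑ k, memInd (z.choice k) D := by
      refine le_trans ?_ (Finset.single_le_sum (f := fun k => memInd (z.choice k) D)
        (fun _ _ => memInd_nonneg _ _) (Finset.mem_univ k))
      simp [memInd, hk]
    have h2 : ((D ∪ z.choices).card : ℝ) ≤ D.card + d := by
      exact_mod_cast (Finset.card_union_le _ _).trans
        (Nat.add_le_add_left z.card_choices_le _)
    have h3 : (d : ℝ) * 1 ≤ d * ∑ k, memInd (z.choice k) D :=
      mul_le_mul_of_nonneg_left h1 (Nat.cast_nonneg d)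
    linarith
  · exact le_add_of_nonneg_right (mul_nonneg (Nat.cast_nonneg d) h0)

/-- The ball whose choices are those of `z` moved by `c`. -/
def BallData.translate (c : ZMod n) : BallData n d ≃ BallData n d :=
  (Equiv.addRight c).prodCongr (Equiv.refl _)

theorem BallData.choice_translate (c : ZMod n) (z : BallData n d) (k : Fin d) :
    (BallData.translate c z).choice k = z.choice k + c := by
  change z.f + c + (k : ℕ) * (z.g : ZMod n) = z.f + (k : ℕ) * (z.g : ZMod n) + c
  ring

/-- Translation symmetry makes all bins equivalent, so `tailProb` need only look at bin 0. -/
theorem placeBall_translate (c : ZMod n) (x : ZMod n → ℕ) (z : BallData n d) :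
    placeBall (fun b => x (b + c)) z = fun b => placeBall x (BallData.translate c z) (b + c) := by
  funext b
  have hsel : ∀ k, z.Selects (fun b => x (b + c)) k ↔ (BallData.translate c z).Selects x k := by
    intro k
    simp only [BallData.Selects, BallData.choice_translate]
    rfl
  have e : (∃ k, z.Selects (fun b => x (b + c)) k ∧ z.choice k = b) ↔
      ∃ k, (BallData.translate c z).Selects x k ∧ (BallData.translate c z).choice k = b + c :=
    exists_congr fun k => by rw [hsel, BallData.choice_translate, add_left_inj]
  simp only [placeBall]
  split_ifs with h1 h2 h2
  · rfl
  · exact absurd (e.1 h1) h2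
  · exact absurd (e.2 h2) h1
  · rfl

variable [NeZero n]

/-- The number of bins that hold at least `i` balls. -/
noncomputable def levelCount (i : ℕ) (x : ZMod n → ℕ) : ℝ :=
  ∑ b, loadInd i b x

theorem levelCount_nonneg (i : ℕ) (x : ZMod n → ℕ) : 0 ≤ levelCount i x :=
  Finset.sum_nonneg fun _ _ => (loadInd_mem_Icc _ _ _).1

theorem levelCount_mono {i : ℕ} {x y : ZMod n → ℕ} (h : ∀ b, x b ≤ y b) :
    levelCount i x ≤ levelCount i y :=
  Finset.sum_le_sum fun b _ => loadInd_mono (h b)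

/-- The count grows exactly when the selected, least loaded choice holds exactly i balls. -/
theorem levelCount_placeBall (hd : 0 < d) (i : ℕ) (x : ZMod n → ℕ) (z : BallData n d) :
    levelCount (i + 1) (placeBall x z)
      = levelCount (i + 1) x + (allInd i z x - allInd (i + 1) z x) := by
  obtain ⟨k, hk⟩ := z.exists_selects hd x
  rw [allInd_eq hk, allInd_eq hk, placeBall_eq_update hk, levelCount, levelCount,
    ← sub_eq_iff_eq_add', ← Finset.sum_sub_distrib, Finset.sum_eq_single (z.choice k)]
  · rw [loadInd, loadInd, loadInd, Function.update_self]
    split_ifs <;> first | omega | norm_num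
  · intro b _ hb
    rw [loadInd, loadInd, Function.update_of_ne hb, sub_self]
  · simp

end Placement

/-! ### Spread of a discrepancy and decorrelation of the loads. -/

section Decorrelation

open scoped BigOperators

variable {n d : ℕ} [NeZero n]

theorem sum_memInd (D : Finset (ZMod n)) : ∑ b, memInd b D = D.card := by
  simp [memInd]

theorem expect_memInd_choice (D : Finset (ZMod n)) (k : Fin d) :
    𝔼 z : BallData n d, memInd (z.choice k) D = D.card / n := by
  rw [BallData.expect_choice (fun b => memInd b D), Fintype.expect_eq_sum_div_card, sum_memInd,
    ZMod.card]

/-- Each of the d choices is uniform, so a union bound gives mean growth at most d · d|D|/n per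
ball. -/
theorem avgStep_spread_pow_card_le (s : ℕ) (D : Finset (ZMod n)) :
    (avgStep (spread (n := n) (d := d)) ^ s) (fun D => (D.card : ℝ)) D
      ≤ (1 + (d : ℝ) ^ 2 / n) ^ s * D.card := by
  induction s with
  | zero => simp
  | succ s ih =>
    have hstep : ∀ D, avgStep (spread (n := n) (d := d)) (fun D => (D.card : ℝ)) D
        ≤ ((1 + (d : ℝ) ^ 2 / n) • fun D : Finset (ZMod n) => (D.card : ℝ)) D := by
      intro D
      rw [avgStep_apply]
      refine (Finset.expect_le_expect fun z _ => card_spread_le D z).trans_eq ?_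
      rw [Finset.expect_add_distrib, Fintype.expect_const, ← Finset.mul_expect,
        Finset.expect_sum_comm]
      simp only [expect_memInd_choice, Finset.sum_const, Finset.card_univ, Fintype.card_fin,
        Pi.smul_apply, smul_eq_mul, nsmul_eq_mul]
      ring
    rw [avgStep_pow_succ_apply']
    refine (avgStep_pow_mono _ _ hstep D).trans ?_
    rw [map_smul, Pi.smul_apply, smul_eq_mul, pow_succ' _ s, mul_assoc]
    exact mul_le_mul_of_nonneg_left ih (by positivity)

/-- A bound for the expected size of the set reached by a discrepancy in two balls. -/
noncomputable def spreadConst (d : ℕ) : ℝ := 2 * d * Real.exp ((d : ℝ) ^ 2)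

theorem spreadConst_nonneg (d : ℕ) : 0 ≤ spreadConst d := by
  unfold spreadConst
  positivity

theorem avgStep_spread_pow_card_choices_le {s : ℕ} (hs : s ≤ n) (z z' : BallData n d) :
    (avgStep (spread (n := n) (d := d)) ^ s) (fun D => (D.card : ℝ)) (z.choices ∪ z'.choices)
      ≤ spreadConst d := by
  refine (avgStep_spread_pow_card_le s _).trans ?_
  have hn : (0 : ℝ) < n := Nat.cast_pos.2 (Nat.pos_of_ne_zero (NeZero.ne n))
  have h1 : (1 + (d : ℝ) ^ 2 / n) ^ s ≤ Real.exp ((d : ℝ) ^ 2) := by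
    calc (1 + (d : ℝ) ^ 2 / n) ^ s ≤ (1 + (d : ℝ) ^ 2 / n) ^ n :=
          pow_le_pow_right₀ (le_add_of_nonneg_right (by positivity)) hs
      _ ≤ Real.exp ((d : ℝ) ^ 2 / n) ^ n := by
          gcongr
          linarith [Real.add_one_le_exp ((d : ℝ) ^ 2 / n)]
      _ = Real.exp ((d : ℝ) ^ 2) := by
          rw [← Real.exp_nat_mul, mul_div_cancel₀ _ hn.ne']
  have h2 : ((z.choices ∪ z'.choices).card : ℝ) ≤ 2 * d := by
    have := (Finset.card_union_le z.choices z'.choices).trans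
      (Nat.add_le_add z.card_choices_le z'.card_choices_le)
    rw [← two_mul] at this
    exact_mod_cast this
  calc _ ≤ Real.exp ((d : ℝ) ^ 2) * (2 * d) :=
        mul_le_mul h1 h2 (Nat.cast_nonneg _) (Real.exp_pos _).le
    _ = spreadConst d := by rw [spreadConst, mul_comm]

theorem sum_avgStep_spread_pow_memInd_le {s : ℕ} (hs : s ≤ n) (z z' : BallData n d) :
    ∑ b, (avgStep (spread (n := n) (d := d)) ^ s) (memInd b) (z.choices ∪ z'.choices)
      ≤ spreadConst d := by
  rw [← avgStep_pow_sum]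
  simp only [sum_memInd]
  exact avgStep_spread_pow_card_choices_le hs z z'

/-- The bound for the covariance after `m` balls, for the loads started from any state. -/
noncomputable def ballCovBound (n d : ℕ) [NeZero n] (m : ℕ) (H K : Finset (ZMod n) → ℝ) : ℝ :=
  covBound (spread (n := n) (d := d)) (fun z z' => z.choices ∪ z'.choices) m H K

theorem ballCovBound_card_le {m : ℕ} (hm : m ≤ n) :
    ballCovBound n d m (fun D => (D.card : ℝ)) (fun D => (D.card : ℝ))
      ≤ n * (spreadConst d ^ 2 / 2) := by
  have h : ∀ s ∈ Finset.range m, 1 / 2 * 𝔼 z : BallData n d, 𝔼 z' : BallData n d,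
      (avgStep (spread (n := n) (d := d)) ^ s) (fun D => (D.card : ℝ)) (z.choices ∪ z'.choices)
      * (avgStep (spread (n := n) (d := d)) ^ s) (fun D => (D.card : ℝ))
        (z.choices ∪ z'.choices) ≤ spreadConst d ^ 2 / 2 := by
    intro s hs
    have hs' : s ≤ n := (Finset.mem_range.1 hs).le.trans hm
    rw [div_eq_inv_mul (spreadConst d ^ 2), ← one_div]
    refine mul_le_mul_of_nonneg_left ?_ (by norm_num)
    refine Finset.expect_le Finset.univ_nonempty fun z _ =>
      Finset.expect_le Finset.univ_nonempty fun z' _ => ?_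
    rw [pow_two]
    exact mul_le_mul (avgStep_spread_pow_card_choices_le hs' z z')
      (avgStep_spread_pow_card_choices_le hs' z z')
      (avgStep_pow_nonneg _ _ (fun _ => Nat.cast_nonneg _) _) (spreadConst_nonneg d)
  refine (Finset.sum_le_card_nsmul _ _ _ h).trans ?_
  rw [Finset.card_range, nsmul_eq_mul]
  exact mul_le_mul_of_nonneg_right (Nat.cast_le.2 hm) (by positivity)

theorem expect_ballCovBound_memInd_le {m : ℕ} (hm : m ≤ n) {j k : Fin d} (hjk : j ≠ k) :
    𝔼 z : BallData n d, ballCovBound n d m (memInd (z.choice j)) (memInd (z.choice k))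
      ≤ d * spreadConst d ^ 2 / (2 * n.totient) := by
  have hn : (0 : ℝ) < n := Nat.cast_pos.2 (Nat.pos_of_ne_zero (NeZero.ne n))
  unfold ballCovBound covBound
  rw [Finset.expect_sum_comm]
  have h : ∀ s ∈ Finset.range m, 𝔼 y : BallData n d, 1 / 2 * 𝔼 z : BallData n d,
      𝔼 z' : BallData n d,
      (avgStep (spread (n := n) (d := d)) ^ s) (memInd (y.choice j)) (z.choices ∪ z'.choices)
      * (avgStep (spread (n := n) (d := d)) ^ s) (memInd (y.choice k))
        (z.choices ∪ z'.choices) ≤ 1 / 2 * (d * spreadConst d ^ 2 / (n * n.totient)) := by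
    intro s hs
    have hs' : s ≤ n := (Finset.mem_range.1 hs).le.trans hm
    rw [← Finset.mul_expect]
    refine mul_le_mul_of_nonneg_left ?_ (by norm_num)
    -- The test ball y is averaged innermost. For fixed z, z' the reach probabilities sum over all
    -- bins to at most `spreadConst d`.
    rw [Finset.expect_comm]
    refine Finset.expect_le Finset.univ_nonempty fun z _ => ?_
    rw [Finset.expect_comm]
    refine Finset.expect_le Finset.univ_nonempty fun z' _ => ?_
    have hnn : ∀ b, 0 ≤ (avgStep (spread (n := n) (d := d)) ^ s) (memInd b)
        (z.choices ∪ z'.choices) := fun b => avgStep_pow_nonneg _ _ (memInd_nonneg b) _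
    refine (BallData.expect_choice_mul_choice_le hnn hnn hjk).trans ?_
    rw [mul_assoc, pow_two]
    gcongr
    · exact Finset.sum_nonneg fun b _ => hnn b
    · exact spreadConst_nonneg d
    · exact sum_avgStep_spread_pow_memInd_le hs' z z'
    · exact sum_avgStep_spread_pow_memInd_le hs' z z'
  refine (Finset.sum_le_card_nsmul _ _ _ h).trans ?_
  rw [Finset.card_range, nsmul_eq_mul]
  have hpos : 0 ≤ 1 / 2 * (d * spreadConst d ^ 2 / (n * n.totient)) := by positivity
  refine (mul_le_mul_of_nonneg_right (Nat.cast_le.2 hm) hpos).trans_eq ?_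
  have ht : (0 : ℝ) < n.totient :=
    Nat.cast_pos.2 (Nat.totient_pos.2 (Nat.pos_of_ne_zero (NeZero.ne n)))
  field_simp

/-- The probability that bin `0` holds at least `i` of the first `m` balls. -/
noncomputable def tailProb (n d : ℕ) [NeZero n] (i m : ℕ) : ℝ :=
  (avgStep (placeBall (n := n) (d := d)) ^ m) (loadInd i 0) (fun _ => 0)

/-- The probability that all the choices of a further ball hold at least `i` of the first `m`
balls. -/
noncomputable def allProb (n d : ℕ) [NeZero n] (i m : ℕ) : ℝ :=
  (avgStep (placeBall (n := n) (d := d)) ^ m) (fun x => 𝔼 z : BallData n d, allInd i z x)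
    (fun _ => 0)

theorem avgStep_placeBall_pow_translate (c : ZMod n) (m : ℕ) (F : (ZMod n → ℕ) → ℝ)
    (x : ZMod n → ℕ) :
    (avgStep (placeBall (n := n) (d := d)) ^ m) F (fun b => x (b + c))
      = (avgStep (placeBall (n := n) (d := d)) ^ m) (fun x => F fun b => x (b + c)) x := by
  induction m generalizing x with
  | zero => rfl
  | succ m ih =>
    rw [avgStep_pow_succ_apply, avgStep_pow_succ_apply]
    simp only [placeBall_translate, ih]
    exact Fintype.expect_equiv (BallData.translate c) _ _ fun z => rfl

theorem avgStep_placeBall_pow_loadInd (i m : ℕ) (b : ZMod n) :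
    (avgStep (placeBall (n := n) (d := d)) ^ m) (loadInd i b) (fun _ => 0)
      = tailProb n d i m := by
  have h := avgStep_placeBall_pow_translate (d := d) b m (loadInd i 0) fun _ => 0
  rw [tailProb, h]
  simp only [loadInd, zero_add]
  rfl

theorem abs_allProb_sub_le {m : ℕ} (hm : m ≤ n) (i : ℕ) :
    |allProb n d i m - tailProb n d i m ^ d|
      ≤ d ^ 3 * spreadConst d ^ 2 / (2 * n.totient) := by
  have h1 : allProb n d i m = 𝔼 z : BallData n d,
      (avgStep (placeBall (n := n) (d := d)) ^ m) (allInd i z) (fun _ => 0) :=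
    avgStep_pow_expect _ _ _ _ _
  have h2 : tailProb n d i m ^ d = 𝔼 z : BallData n d, ∏ k,
      (avgStep (placeBall (n := n) (d := d)) ^ m) (loadInd i (z.choice k)) (fun _ => 0) := by
    simp only [avgStep_placeBall_pow_loadInd, Finset.prod_const, Finset.card_univ,
      Fintype.card_fin, Fintype.expect_const]
  rw [h1, h2, ← Finset.expect_sub_distrib]
  refine (Finset.abs_expect_le _ _).trans ?_
  have h3 : ∀ z : BallData n d, |(avgStep (placeBall (n := n) (d := d)) ^ m) (allInd i z)
      (fun _ => 0) - ∏ k, (avgStep (placeBall (n := n) (d := d)) ^ m) (loadInd i (z.choice k))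
        (fun _ => 0)| ≤ ∑ j, ∑ k, if j = k then 0 else
          ballCovBound n d m (memInd (z.choice j)) (memInd (z.choice k)) := fun z =>
    abs_avgStep_pow_prod_sub_le (r := AgreeOff) (fun x x' D y h => h.placeBall y)
      agreeOff_placeBall_placeBall (F := fun k => loadInd i (z.choice k))
      (H := fun k => memInd (z.choice k)) (fun _ _ => loadInd_mem_Icc _ _ _)
      (fun _ _ => memInd_nonneg _ _) (fun k x x' D h => h.abs_loadInd_sub_le i _) m _ Finset.univ
  refine (Finset.expect_le_expect fun z _ => h3 z).trans ?_
  simp only [Finset.expect_sum_comm]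
  have h4 : ∀ j k : Fin d, (𝔼 z : BallData n d, if j = k then 0 else
      ballCovBound n d m (memInd (z.choice j)) (memInd (z.choice k)))
      ≤ d * spreadConst d ^ 2 / (2 * n.totient) := by
    intro j k
    by_cases hjk : j = k
    · simp only [if_pos hjk, Fintype.expect_const]
      positivity
    · simp only [if_neg hjk]
      exact expect_ballCovBound_memInd_le hm hjk
  refine (Finset.sum_le_sum fun j _ => Finset.sum_le_sum fun k _ => h4 j k).trans_eq ?_
  simp only [Finset.sum_const, Finset.card_univ, Fintype.card_fin, nsmul_eq_mul]
  ring

theorem avgStep_placeBall_pow_levelCount (i m : ℕ) :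
    (avgStep (placeBall (n := n) (d := d)) ^ m) (levelCount i) (fun _ => 0)
      = n * tailProb n d i m := by
  have h := avgStep_pow_sum (placeBall (n := n) (d := d)) m Finset.univ (loadInd i) fun _ => 0
  simp only [avgStep_placeBall_pow_loadInd, Finset.sum_const, Finset.card_univ, ZMod.card,
    nsmul_eq_mul] at h
  exact h

/-- A discrepancy on D changes the count by at most |D|. -/
theorem variance_levelCount_le {m : ℕ} (hm : m ≤ n) (i : ℕ) :
    (avgStep (placeBall (n := n) (d := d)) ^ m) (levelCount i * levelCount i) (fun _ => 0)
      - (n * tailProb n d i m) ^ 2 ≤ n * (spreadConst d ^ 2 / 2) := by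
  have hF : ∀ (x x' : ZMod n → ℕ) D, AgreeOff x x' D →
      |levelCount i x - levelCount i x'| ≤ (D.card : ℝ) := by
    intro x x' D h
    rw [← sum_memInd, levelCount, levelCount, ← Finset.sum_sub_distrib]
    exact (Finset.abs_sum_le_sum_abs _ _).trans
      (Finset.sum_le_sum fun b _ => h.abs_loadInd_sub_le i b)
  have h := abs_cov_avgStep_pow_le (r := AgreeOff)
    (fun x x' D (y : BallData n d) h => h.placeBall y) agreeOff_placeBall_placeBall hF hF m
    fun _ => 0
  rw [avgStep_placeBall_pow_levelCount] at h
  rw [pow_two (n * tailProb n d i m)]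
  exact (le_abs_self _).trans (h.trans (ballCovBound_card_le hm))

theorem tailProb_succ (hd : 0 < d) (i m : ℕ) :
    tailProb n d (i + 1) (m + 1)
      = tailProb n d (i + 1) m + (allProb n d i m - allProb n d (i + 1) m) / n := by
  have hn : (n : ℝ) ≠ 0 := Nat.cast_ne_zero.2 (NeZero.ne n)
  have h : avgStep (placeBall (n := n) (d := d)) (levelCount (i + 1))
      = levelCount (i + 1) + ((fun x => 𝔼 z : BallData n d, allInd i z x)
        - fun x => 𝔼 z : BallData n d, allInd (i + 1) z x) := by
    funext x
    rw [avgStep_apply]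
    simp only [levelCount_placeBall hd, Finset.expect_add_distrib, Finset.expect_sub_distrib,
      Fintype.expect_const, Pi.add_apply, Pi.sub_apply]
  have h2 := avgStep_placeBall_pow_levelCount (n := n) (d := d) (i + 1) (m + 1)
  rw [avgStep_pow_succ_apply', h, map_add, map_sub, Pi.add_apply, Pi.sub_apply,
    avgStep_placeBall_pow_levelCount] at h2
  change n * tailProb n d (i + 1) m + (allProb n d i m - allProb n d (i + 1) m)
    = n * tailProb n d (i + 1) (m + 1) at h2
  field_simp
  linarith

theorem avgStep_placeBall_pow_monotone {F : (ZMod n → ℕ) → ℝ}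
    (hF : ∀ x y, (∀ b, x b ≤ y b) → F x ≤ F y) (x : ZMod n → ℕ) :
    Monotone fun m => (avgStep (placeBall (n := n) (d := d)) ^ m) F x := by
  refine monotone_nat_of_le_succ fun m => ?_
  rw [avgStep_pow_succ_apply']
  refine avgStep_pow_mono _ _ (fun y => ?_) x
  rw [avgStep_apply]
  exact Finset.le_expect Finset.univ_nonempty fun z _ => hF _ _ (le_placeBall y z)

theorem tailProb_monotone (i : ℕ) : Monotone (tailProb n d i) :=
  avgStep_placeBall_pow_monotone (fun _ _ h => loadInd_mono (h 0)) _

theorem allProb_monotone (i : ℕ) : Monotone (allProb n d i) :=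
  avgStep_placeBall_pow_monotone (F := fun x => 𝔼 z : BallData n d, allInd i z x)
    (fun _ _ h => Finset.expect_le_expect fun _ _ => allInd_mono h) _

theorem tailProb_nonneg (i m : ℕ) : 0 ≤ tailProb n d i m :=
  avgStep_pow_nonneg _ _ (fun _ => (loadInd_mem_Icc _ _ _).1) _

theorem allProb_nonneg (i m : ℕ) : 0 ≤ allProb n d i m :=
  avgStep_pow_nonneg _ _ (fun _ => Finset.expect_nonneg fun _ _ => allInd_nonneg _ _ _) _

theorem allProb_zero (m : ℕ) : allProb n d 0 m = 1 := by
  simp only [allProb, allInd_zero, Fintype.expect_const]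
  exact avgStep_pow_const _ _ _ _

theorem tailProb_succ_zero (i : ℕ) : tailProb n d (i + 1) 0 = 0 := by
  simp [tailProb, loadInd]

theorem tailProb_zero (m : ℕ) : tailProb n d 0 m = 1 := by
  have : (loadInd 0 0 : (ZMod n → ℕ) → ℝ) = fun _ => 1 := by
    funext x
    exact loadInd_zero _ _
  rw [tailProb, this, avgStep_pow_const]

theorem tailProb_succ_le (i m : ℕ) : tailProb n d (i + 1) m ≤ tailProb n d i m := by
  refine avgStep_pow_mono _ _ (fun x => ?_) _
  rw [loadInd, loadInd]
  split_ifs <;> first | omega | norm_num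

end Decorrelation

/-! ### The recursion of the tail probabilities over the levels. -/

section Recursion

variable {n d : ℕ} [NeZero n]

/-- The bound for the difference between `allProb` and the corresponding power of `tailProb`. -/
noncomputable def corrError (n d : ℕ) : ℝ := d ^ 3 * spreadConst d ^ 2 / (2 * n.totient)

theorem corrError_nonneg (n d : ℕ) : 0 ≤ corrError n d := by
  unfold corrError
  positivity

theorem allProb_le {m : ℕ} (hm : m ≤ n) (i : ℕ) :
    allProb n d i m ≤ tailProb n d i m ^ d + corrError n d := by
  have := (abs_le.1 (abs_allProb_sub_le (d := d) hm i)).2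
  rw [corrError]
  linarith

theorem le_allProb {m : ℕ} (hm : m ≤ n) (i : ℕ) :
    tailProb n d i m ^ d - corrError n d ≤ allProb n d i m := by
  have := (abs_le.1 (abs_allProb_sub_le (d := d) hm i)).1
  rw [corrError]
  linarith

/-- Each of the n increments is at most `allProb n d i n / n`, by monotonicity in time. -/
theorem tailProb_succ_le_pow_add (hd : 0 < d) (i : ℕ) :
    tailProb n d (i + 1) n ≤ tailProb n d i n ^ d + corrError n d := by
  have hn : (0 : ℝ) < n := Nat.cast_pos.2 (Nat.pos_of_ne_zero (NeZero.ne n))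
  have h : ∀ m ≤ n, tailProb n d (i + 1) m ≤ m * (allProb n d i n / n) := by
    intro m
    induction m with
    | zero => simp [tailProb_succ_zero]
    | succ m ih =>
      intro hm
      have h1 := ih (Nat.le_of_succ_le hm)
      have h2 : (allProb n d i m - allProb n d (i + 1) m) / n ≤ allProb n d i n / n := by
        refine div_le_div_of_nonneg_right ?_ hn.le
        have := allProb_monotone (n := n) (d := d) i (Nat.le_of_succ_le hm)
        have := allProb_nonneg (n := n) (d := d) (i + 1) m
        linarith
      rw [tailProb_succ hd]
      push_cast
      linarith
  have h1 := h n le_rfl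
  rw [mul_div_cancel₀ _ hn.ne'] at h1
  exact h1.trans (allProb_le le_rfl i)

/-- The increments of p_1 + p_2 telescope to at most 1/n per ball, so p_1 + p_2 ≤ 1, while p_2 ≤
p_1. This starts the decay below 1. -/
theorem tailProb_two_le_half (hd : 0 < d) : tailProb n d 2 n ≤ 1 / 2 := by
  have hn : (0 : ℝ) < n := Nat.cast_pos.2 (Nat.pos_of_ne_zero (NeZero.ne n))
  have h : ∀ m, tailProb n d 1 m + tailProb n d 2 m ≤ m * (1 / n) := by
    intro m
    induction m with
    | zero => simp [tailProb_succ_zero]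
    | succ m ih =>
      have h2 : (1 - allProb n d 2 m) / n ≤ 1 / n := by
        refine div_le_div_of_nonneg_right ?_ hn.le
        linarith [allProb_nonneg (n := n) (d := d) 2 m]
      have h3 := tailProb_succ (n := n) hd 0 m
      have h4 := tailProb_succ (n := n) hd 1 m
      norm_num only at h3 h4
      rw [allProb_zero] at h3
      have h5 : (1 - allProb n d 1 m) / n + (allProb n d 1 m - allProb n d 2 m) / n
          = (1 - allProb n d 2 m) / n := by
        rw [← add_div]
        ring
      rw [h3, h4]
      push_cast
      linarith
  have h1 := h n
  rw [mul_one_div_cancel hn.ne'] at h1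
  have h2 : tailProb n d 2 n ≤ tailProb n d 1 n := tailProb_succ_le 1 n
  linarith

/-- If the error dominates, the new bound is 2e. Otherwise x > 2e, since x ≤ 2e ≤ 1/2 would give x^d
≤ x² ≤ e; hence x ≤ y. The form with a maximum thus survives iteration. -/
theorem pow_add_le_max {x y e : ℝ} {d : ℕ} (hd : 3 ≤ d) (hx : 0 ≤ x) (he : 0 ≤ e)
    (he4 : e ≤ 1 / 4) (hxy : x ≤ max y (2 * e)) : x ^ d + e ≤ max (2 * y ^ d) (2 * e) := by
  by_cases h : x ^ d ≤ e
  · exact le_max_of_le_right (by linarith)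
  · have h2 : ¬ x ≤ 2 * e := fun h2 => h <| by
      have h3 : x ≤ 1 / 2 := by linarith
      calc x ^ d ≤ x ^ 2 := pow_le_pow_of_le_one hx (by linarith) (by omega)
        _ = x * x := pow_two x
        _ ≤ 2 * e * (1 / 2) := mul_le_mul h2 h3 hx (by linarith)
        _ = e := by ring
    have h3 : x ≤ y := (le_max_iff.1 hxy).resolve_right h2
    have h4 : x ^ d ≤ y ^ d := pow_le_pow_left₀ hx h3 d
    exact le_max_of_le_left (by linarith)

/-- The prefactor 1/2 absorbs the doubling in `pow_add_le_max`, as 2 (1/2)^d ≤ 1/2. -/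
theorem tailProb_add_three_le (hd : 3 ≤ d) (he : corrError n d ≤ 1 / 4) (i : ℕ) :
    tailProb n d (i + 3) n ≤ max (1 / 2 * (1 / 2) ^ d ^ i) (2 * corrError n d) := by
  have hd0 : 0 < d := by omega
  have he0 := corrError_nonneg n d
  induction i with
  | zero =>
    refine (tailProb_succ_le_pow_add hd0 2).trans ?_
    refine (pow_add_le_max hd (tailProb_nonneg _ _) he0 he
      (le_max_of_le_left (tailProb_two_le_half hd0))).trans (max_le_max ?_ le_rfl)
    have : (1 / 2 : ℝ) ^ d ≤ (1 / 2) ^ 3 :=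
      pow_le_pow_of_le_one (by norm_num) (by norm_num) hd
    norm_num at this ⊢
    linarith
  | succ i ih =>
    refine (tailProb_succ_le_pow_add hd0 (i + 3)).trans ?_
    refine (pow_add_le_max hd (tailProb_nonneg _ _) he0 he ih).trans (max_le_max ?_ le_rfl)
    have h1 : (1 / 2 : ℝ) ^ d ≤ (1 / 2) ^ 2 :=
      pow_le_pow_of_le_one (by norm_num) (by norm_num) (by omega)
    rw [mul_pow, ← pow_mul, ← pow_succ, ← mul_assoc]
    refine mul_le_mul_of_nonneg_right ?_ (by positivity)
    linarith

/-- The exponents of `1 / 2` in the lower bounds for the probabilities `tailProb`. -/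
def lowerExponent (d : ℕ) : ℕ → ℕ
  | 0 => 1
  | i + 1 => d * lowerExponent d i + i + 3

/-- The summand i + 5 strengthens the induction: d(i + 5) pays for the additive terms of the next
step. -/
theorem lowerExponent_add_le {d : ℕ} (hd : 3 ≤ d) (i : ℕ) :
    lowerExponent d i + i + 5 ≤ 6 * d ^ i := by
  induction i with
  | zero => simp [lowerExponent]
  | succ i ih =>
    have h := Nat.mul_le_mul_left d ih
    have h2 : d * (6 * d ^ i) = 6 * d ^ (i + 1) := by ring
    have h3 : 3 * (i + 5) ≤ d * (i + 5) := Nat.mul_le_mul_right _ hd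
    have h4 : d * (lowerExponent d i + i + 5) = d * lowerExponent d i + d * (i + 5) := by ring
    rw [lowerExponent]
    omega

theorem tailProb_add_le {i s : ℕ} (hd : 0 < d) {t : ℕ} {c : ℝ}
    (h : ∀ m, s ≤ m → m < t → c ≤ allProb n d i m - allProb n d (i + 1) m) (hst : s ≤ t) :
    (t - s) * (c / n) ≤ tailProb n d (i + 1) t := by
  induction t, hst using Nat.le_induction with
  | base => simpa using tailProb_nonneg _ _
  | succ t hst ih =>
    have h1 := ih fun m hm hmt => h m hm (hmt.trans (Nat.lt_succ_self t))
    have h2 : c / n ≤ (allProb n d i t - allProb n d (i + 1) t) / n :=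
      div_le_div_of_nonneg_right (h t hst (Nat.lt_succ_self t)) (Nat.cast_nonneg n)
    rw [tailProb_succ hd]
    push_cast
    linarith

/-- Level i + 1 is built between times n - n/2^i and n - n/2^(i+1). This window has length at least
n/2^(i+2) and the increments are at least a^d/(2n), whence the factor (1/2)^(i+3). -/
theorem pow_lowerExponent_le_tailProb (hd : 3 ≤ d) (i : ℕ)
    (he : 8 * corrError n d ≤ (1 / 2) ^ (6 * d ^ i)) (hi : 2 ^ i ≤ n) :
    (1 / 2) ^ lowerExponent d i ≤ tailProb n d i (n - n / 2 ^ i) := by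
  have hn : (0 : ℝ) < n := Nat.cast_pos.2 (Nat.pos_of_ne_zero (NeZero.ne n))
  induction i with
  | zero =>
    rw [tailProb_zero]
    norm_num [lowerExponent]
  | succ i ih =>
    have h0 : (0 : ℝ) ≤ 1 / 2 := by norm_num
    have h1 : (1 / 2 : ℝ) ≤ 1 := by norm_num
    have hi' : 2 ^ i ≤ n := (Nat.pow_le_pow_right two_pos (Nat.le_succ i)).trans hi
    have hexp : 6 * d ^ i ≤ 6 * d ^ (i + 1) :=
      Nat.mul_le_mul_left _ (Nat.pow_le_pow_right (by omega) (Nat.le_succ i))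
    have hih := ih (he.trans (pow_le_pow_of_le_one h0 h1 hexp)) hi'
    set a : ℝ := (1 / 2) ^ lowerExponent d i with ha
    have ha0 : 0 ≤ a := pow_nonneg h0 _
    have had : 8 * corrError n d ≤ a ^ d := by
      refine he.trans ?_
      rw [ha, ← pow_mul]
      refine pow_le_pow_of_le_one h0 h1 ?_
      calc lowerExponent d i * d ≤ 6 * d ^ i * d :=
            Nat.mul_le_mul_right _ (by have := lowerExponent_add_le hd i; omega)
        _ = 6 * d ^ (i + 1) := by ring
    have ha' : (1 / 2 : ℝ) ^ lowerExponent d (i + 1) = a ^ d * (1 / 2) ^ (i + 3) := by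
      rw [ha, ← pow_mul, ← pow_add, lowerExponent]
      congr 1
      ring
    -- If the bound fails at the end of the window, p_{i+1} < a' throughout it, so the loss to level
    -- i + 1 is small: a^d - a'^d - 2 `corrError` ≥ a^d/2.
    by_contra! hlt
    set a' : ℝ := (1 / 2) ^ lowerExponent d (i + 1)
    have ha'0 : 0 ≤ a' := pow_nonneg h0 _
    have ha'1 : a' ≤ a ^ d / 8 := by
      rw [ha']
      have : (1 / 2 : ℝ) ^ (i + 3) ≤ (1 / 2) ^ 3 := pow_le_pow_of_le_one h0 h1 (by omega)
      have := mul_le_mul_of_nonneg_left this (pow_nonneg ha0 d)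
      norm_num at this ⊢
      linarith
    have had1 : a ^ d ≤ 1 := pow_le_one₀ ha0 (pow_le_one₀ h0 h1)
    have ha'd : a' ^ d ≤ a' := pow_le_of_le_one ha'0 (by linarith) (by omega)
    have hdiv : n / 2 ^ (i + 1) = n / 2 ^ i / 2 := by rw [pow_succ, Nat.div_div_eq_div_mul]
    have hu1 : 1 ≤ n / 2 ^ i := (Nat.one_le_div_iff (by positivity)).2 hi'
    have hu2 : n < 2 ^ i * (n / 2 ^ i + 1) := Nat.lt_mul_div_succ n (by positivity)
    have hun : n / 2 ^ i ≤ n := Nat.div_le_self _ _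
    rw [hdiv] at hlt
    set u := n / 2 ^ i
    have hinc : ∀ m, n - u ≤ m → m < n - u / 2 →
        a ^ d / 2 ≤ allProb n d i m - allProb n d (i + 1) m := by
      intro m hm hmt
      have hmn : m ≤ n := by omega
      have h2 := le_allProb (d := d) hmn i
      have h3 := allProb_le (d := d) hmn (i + 1)
      have h4 : a ^ d ≤ tailProb n d i m ^ d :=
        pow_le_pow_left₀ ha0 (hih.trans (tailProb_monotone i hm)) d
      have h5 : tailProb n d (i + 1) m ^ d ≤ a' ^ d :=
        pow_le_pow_left₀ (tailProb_nonneg _ _)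
          ((tailProb_monotone (i + 1) hmt.le).trans hlt.le) d
      linarith
    have hle := tailProb_add_le (by omega) hinc (by omega)
    have hlen : (n : ℝ) ≤ 2 ^ (i + 2) * ((n - u / 2 : ℕ) - (n - u : ℕ) : ℝ) := by
      have h2 : n - u / 2 = (n - u) + (u - u / 2) := by omega
      rw [h2]
      push_cast
      rw [add_sub_cancel_left]
      have h3 : n ≤ 2 ^ (i + 2) * (u - u / 2) := by
        calc n ≤ 2 ^ i * (u + 1) := hu2.le
          _ ≤ 2 ^ i * (4 * (u - u / 2)) := Nat.mul_le_mul_left _ (by omega)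
          _ = 2 ^ (i + 2) * (u - u / 2) := by ring
      exact_mod_cast h3
    have hfin : a' ≤ ((n - u / 2 : ℕ) - (n - u : ℕ) : ℝ) * (a ^ d / 2 / n) := by
      rw [ha']
      have h2 : a ^ d * (1 / 2) ^ (i + 3) = a ^ d / 2 / n * (n / 2 ^ (i + 2)) := by
        rw [one_div, inv_pow]
        field_simp
        ring
      rw [h2, mul_comm]
      refine mul_le_mul_of_nonneg_right ?_ (by positivity)
      rw [div_le_iff₀ (by positivity), mul_comm]
      exact hlen
    linarith

end Recursion

/-! ### From tail probabilities to the maximum load. -/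

section MaximumLoad

open scoped BigOperators

variable {n d : ℕ} [NeZero n]

theorem ballsLaw_eq_ofReal (m : ℕ) (S : Set (Fin m → BallData n d)) [DecidablePred (· ∈ S)] :
    ballsLaw n d m S = ENNReal.ofReal (𝔼 ω, if ω ∈ S then 1 else 0) := by
  rw [ballsLaw, ProbabilityTheory.uniformOn, ProbabilityTheory.cond_apply MeasurableSet.univ,
    Set.univ_inter, MeasureTheory.Measure.count_apply_finite _ Set.finite_univ,
    MeasureTheory.Measure.count_apply_finite _ S.toFinite, Fintype.expect_eq_sum_div_card,
    Finset.sum_boole, ENNReal.ofReal_div_of_pos (Nat.cast_pos.2 Fintype.card_pos),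
    ENNReal.ofReal_natCast, ENNReal.ofReal_natCast, ENNReal.div_eq_inv_mul]
  congr 3
  · simp
  · ext ω
    simp

theorem expect_finalLoads (m : ℕ) (F : (ZMod n → ℕ) → ℝ) :
    𝔼 ω : Fin m → BallData n d, F (finalLoads ω)
      = (avgStep (placeBall (n := n) (d := d)) ^ m) F (fun _ => 0) :=
  expect_foldl_ofFn _ _ _ _

theorem le_maxLoad_iff {m i : ℕ} (ω : Fin m → BallData n d) :
    i ≤ maxLoad ω ↔ ∃ b, i ≤ finalLoads ω b := by
  constructor
  · intro h
    obtain ⟨b, hb⟩ := exists_eq_ciSup_of_finite (f := finalLoads ω)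
    exact ⟨b, h.trans_eq hb.symm⟩
  · rintro ⟨b, hb⟩
    exact hb.trans (le_ciSup (Set.finite_range _).bddAbove b)

/-- The indicator that some bin holds at least `i` balls. -/
noncomputable def someInd (i : ℕ) (x : ZMod n → ℕ) : ℝ :=
  open Classical in if ∃ b, i ≤ x b then 1 else 0

theorem someInd_succ_placeBall_le (hd : 0 < d) (i : ℕ) (x : ZMod n → ℕ) (z : BallData n d) :
    someInd (i + 1) (placeBall x z) ≤ someInd (i + 1) x + allInd i z x := by
  obtain ⟨k, hk⟩ := z.exists_selects hd x
  rw [allInd_eq hk, placeBall_eq_update hk]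
  by_cases h : ∃ b, i + 1 ≤ x b
  · have h1 : someInd (i + 1) x = 1 := if_pos h
    have h2 : someInd (i + 1) (Function.update x (z.choice k) (x (z.choice k) + 1)) ≤ 1 := by
      rw [someInd]
      split_ifs <;> norm_num
    linarith [(loadInd_mem_Icc i (z.choice k) x).1]
  · by_cases h' : i ≤ x (z.choice k)
    · rw [loadInd, if_pos h', someInd, someInd, if_neg h]
      split_ifs
      · exact (zero_add _).ge
      · norm_num
    · have h3 : someInd (i + 1) (Function.update x (z.choice k) (x (z.choice k) + 1)) = 0 := by
        refine if_neg ?_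
        rintro ⟨b, hb⟩
        by_cases hbk : b = z.choice k
        · rw [hbk, Function.update_self] at hb
          omega
        · rw [Function.update_of_ne hbk] at hb
          exact h ⟨b, hb⟩
      rw [h3]
      have : 0 ≤ someInd (i + 1) x := by
        rw [someInd]
        split_ifs <;> norm_num
      linarith [(loadInd_mem_Icc i (z.choice k) x).1]

/-- Two adjacent choices suffice; their index difference 1 makes the constant 1. -/
theorem expect_allInd_le (hd : 2 ≤ d) (i : ℕ) (x : ZMod n → ℕ) :
    𝔼 z : BallData n d, allInd i z x ≤ levelCount i x ^ 2 / (n * n.totient) := by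
  have hlt : (⟨0, by omega⟩ : Fin d) < ⟨1, by omega⟩ := Fin.mk_lt_mk.2 one_pos
  have hnn : ∀ v, 0 ≤ loadInd i v x := fun v => (loadInd_mem_Icc i v x).1
  have h := BallData.expect_choice_mul_choice_le_of_lt (n := n) hnn hnn hlt
  refine le_trans (Finset.expect_le_expect fun z _ => ?_) (h.trans_eq ?_)
  · have h01 := fun k => loadInd_mem_Icc i (z.choice k) x
    rw [allInd, ← Finset.prod_pair hlt.ne (f := fun k => loadInd i (z.choice k) x),
      ← Finset.prod_sdiff (Finset.subset_univ _)]
    exact mul_le_of_le_one_left (Finset.prod_nonneg fun k _ => (h01 k).1)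
      (Finset.prod_le_one (fun k _ => (h01 k).1) fun k _ => (h01 k).2)
  · rw [levelCount]
    simp [pow_two]

/-- A union bound over the balls while at most l bins have height i, and Markov's inequality for the
rest. The recursion with `corrError` would not do here, as n times that error does not tend to 0. -/
theorem avgStep_pow_someInd_succ_le (hd : 2 ≤ d) (i : ℕ) {l : ℝ} (hl : 0 < l) :
    (avgStep (placeBall (n := n) (d := d)) ^ n) (someInd (i + 1)) (fun _ => 0)
      ≤ l ^ 2 / n.totient + n * tailProb n d i n / l := by
  classical
  have hn : (0 : ℝ) < n := Nat.cast_pos.2 (Nat.pos_of_ne_zero (NeZero.ne n))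
  have hsome : ∀ x : ZMod n → ℕ, someInd (i + 1) x ∈ Set.Icc (0 : ℝ) 1 := fun x => by
    rw [someInd]
    split_ifs <;> simp
  -- `levelCount` never decreases, so a path that exceeds l contributes 0 to G forever.
  set G : (ZMod n → ℕ) → ℝ := fun x => if levelCount i x ≤ l then someInd (i + 1) x else 0 with hG
  set c : ℝ := l ^ 2 / (n * n.totient) with hc
  have hc0 : 0 ≤ c := by positivity
  have hstep : ∀ x, avgStep (placeBall (n := n) (d := d)) G x ≤ (G + fun _ => c : (ZMod n → ℕ) → ℝ) x := by
    intro x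
    rw [avgStep_apply, Pi.add_apply]
    by_cases hx : levelCount i x ≤ l
    · have h1 : ∀ z : BallData n d, G (placeBall x z) ≤ someInd (i + 1) x + allInd i z x := by
        intro z
        refine le_trans ?_ (someInd_succ_placeBall_le (by omega) i x z)
        simp only [hG]
        split_ifs
        · exact le_rfl
        · exact (hsome _).1
      refine (Finset.expect_le_expect fun z _ => h1 z).trans ?_
      rw [Finset.expect_add_distrib, Fintype.expect_const]
      simp only [hG, if_pos hx]
      refine add_le_add le_rfl ((expect_allInd_le hd i x).trans ?_)
      exact div_le_div_of_nonneg_right (pow_le_pow_left₀ (levelCount_nonneg i x) hx 2)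
        (by positivity)
    · have h1 : ∀ z : BallData n d, G (placeBall x z) = 0 := fun z =>
        if_neg fun h => hx ((levelCount_mono (le_placeBall x z)).trans h)
      rw [Finset.expect_congr rfl fun z _ => h1 z, Fintype.expect_const]
      simp only [hG, if_neg hx, zero_add]
      exact hc0
  have hpow : ∀ m : ℕ, (avgStep (placeBall (n := n) (d := d)) ^ m) G (fun _ => 0) ≤ m * c := by
    intro m
    induction m with
    | zero =>
      simp [hG, someInd]
    | succ m ih =>
      rw [avgStep_pow_succ_apply']
      refine (avgStep_pow_mono _ _ hstep _).trans ?_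
      rw [map_add, Pi.add_apply, avgStep_pow_const]
      push_cast
      linarith
  have hle : ∀ x : ZMod n → ℕ, someInd (i + 1) x ≤ (G + l⁻¹ • levelCount i : (ZMod n → ℕ) → ℝ) x := by
    intro x
    rw [Pi.add_apply, Pi.smul_apply, smul_eq_mul]
    by_cases hx : levelCount i x ≤ l
    · simp only [hG, if_pos hx]
      exact le_add_of_nonneg_right (mul_nonneg (inv_nonneg.2 hl.le) (levelCount_nonneg i x))
    · simp only [hG, if_neg hx, zero_add]
      refine (hsome x).2.trans ?_
      rw [← div_eq_inv_mul, one_le_div hl]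
      exact (not_le.1 hx).le
  refine (avgStep_pow_mono _ _ hle _).trans ?_
  rw [map_add, map_smul, Pi.add_apply, Pi.smul_apply, avgStep_placeBall_pow_levelCount,
    smul_eq_mul, ← div_eq_inv_mul]
  refine add_le_add ((hpow n).trans_eq ?_) le_rfl
  have ht : (0 : ℝ) < n.totient :=
    Nat.cast_pos.2 (Nat.totient_pos.2 (Nat.pos_of_ne_zero (NeZero.ne n)))
  rw [hc]
  field_simp

/-- Chebyshev: without a bin of height i the count is 0, at distance μ from its mean. -/
theorem avgStep_pow_one_sub_someInd_le (i : ℕ) (hp : 0 < tailProb n d i n) :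
    (avgStep (placeBall (n := n) (d := d)) ^ n) (fun x => 1 - someInd i x) (fun _ => 0)
      ≤ spreadConst d ^ 2 / (2 * (n * tailProb n d i n ^ 2)) := by
  have hn : (0 : ℝ) < n := Nat.cast_pos.2 (Nat.pos_of_ne_zero (NeZero.ne n))
  set μ : ℝ := n * tailProb n d i n with hμ
  have hμ0 : 0 < μ := mul_pos hn hp
  have hle : ∀ x : ZMod n → ℕ, 1 - someInd i x
      ≤ ((μ ^ 2)⁻¹ • (levelCount i * levelCount i - (2 * μ) • levelCount i
        + fun _ => μ ^ 2) : (ZMod n → ℕ) → ℝ) x := by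
    intro x
    have e : ((μ ^ 2)⁻¹ • (levelCount i * levelCount i - (2 * μ) • levelCount i
        + fun _ => μ ^ 2) : (ZMod n → ℕ) → ℝ) x = (levelCount i x - μ) ^ 2 / μ ^ 2 := by
      simp only [Pi.smul_apply, Pi.add_apply, Pi.sub_apply, Pi.mul_apply, smul_eq_mul]
      ring
    rw [e]
    by_cases hx : ∃ b, i ≤ x b
    · rw [someInd, if_pos hx, sub_self]
      positivity
    · have h0 : levelCount i x = 0 :=
        Finset.sum_eq_zero fun b _ => if_neg fun hb => hx ⟨b, hb⟩
      rw [someInd, if_neg hx, h0, sub_zero, zero_sub, neg_sq, div_self (pow_pos hμ0 2).ne']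
  refine (avgStep_pow_mono _ _ hle _).trans ?_
  rw [map_smul, map_add, map_sub, map_smul, Pi.smul_apply, Pi.add_apply, Pi.sub_apply,
    Pi.smul_apply, avgStep_pow_const, avgStep_placeBall_pow_levelCount, smul_eq_mul, smul_eq_mul,
    ← hμ]
  have hvar := variance_levelCount_le (d := d) (le_refl n) i
  rw [← hμ] at hvar
  rw [← div_eq_inv_mul]
  calc _ ≤ n * (spreadConst d ^ 2 / 2) / μ ^ 2 :=
        div_le_div_of_nonneg_right (by linarith) (by positivity)
    _ = spreadConst d ^ 2 / (2 * (n * tailProb n d i n ^ 2)) := by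
        rw [hμ]
        field_simp

/-- The maximum load lies in `[i, j]` except with a small probability. -/
theorem one_sub_le_expect_maxLoad (hd : 2 ≤ d) {i j : ℕ} {l : ℝ} (hl : 0 < l)
    (hp : 0 < tailProb n d i n) (S : Set (Fin n → BallData n d)) [DecidablePred (· ∈ S)]
    (hS : ∀ ω, i ≤ maxLoad ω → maxLoad ω ≤ j → ω ∈ S) :
    1 - (l ^ 2 / n.totient + n * tailProb n d j n / l
      + spreadConst d ^ 2 / (2 * (n * tailProb n d i n ^ 2)))
      ≤ 𝔼 ω : Fin n → BallData n d, if ω ∈ S then (1 : ℝ) else 0 := by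
  have h : ∀ ω : Fin n → BallData n d, 1 - someInd (j + 1) (finalLoads ω)
      - (1 - someInd i (finalLoads ω)) ≤ if ω ∈ S then (1 : ℝ) else 0 := by
    intro ω
    simp only [someInd, ← le_maxLoad_iff]
    split_ifs with h1 h2 h3 h3 h2 h3 h3 <;> norm_num
    exact h3 (hS ω h2 (by omega))
  refine le_trans ?_ (Finset.expect_le_expect fun ω _ => h ω)
  rw [Finset.expect_sub_distrib, Finset.expect_sub_distrib, Fintype.expect_const,
    expect_finalLoads n (someInd (j + 1)), expect_finalLoads n fun x => 1 - someInd i x]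
  have h1 := avgStep_pow_someInd_succ_le (n := n) hd j hl
  have h2 := avgStep_pow_one_sub_someInd_le i hp
  linarith

end MaximumLoad

/-! ### Asymptotics in n. -/

section Asymptotics

theorem one_div_totient_le {n : ℕ} (hn : n ≠ 0) (hlog : 1 ≤ Real.log n) :
    1 / (n.totient : ℝ) ≤ 3 * Real.log n / n := by
  have hn0 : (0 : ℝ) < n := Nat.cast_pos.2 (Nat.pos_of_ne_zero hn)
  have ht : (0 : ℝ) < n.totient := Nat.cast_pos.2 (Nat.totient_pos.2 (Nat.pos_of_ne_zero hn))
  have h1 : (n : ℝ) ≤ (Nat.log 2 n + 1) * n.totient := by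
    exact_mod_cast le_log_add_one_mul_totient hn
  have h2 : (Nat.log 2 n : ℝ) * Real.log 2 ≤ Real.log n := by
    rw [← Real.log_pow]
    refine Real.log_le_log (by positivity) ?_
    exact_mod_cast Nat.pow_log_le_self 2 hn
  have h3 : (Nat.log 2 n : ℝ) * (1 / 2) ≤ Nat.log 2 n * Real.log 2 :=
    mul_le_mul_of_nonneg_left (by linarith [Real.log_two_gt_d9]) (Nat.cast_nonneg _)
  rw [div_le_div_iff₀ ht hn0, one_mul]
  exact h1.trans (mul_le_mul_of_nonneg_right (by linarith) ht.le)

theorem half_pow_eq_exp (m : ℕ) : (1 / 2 : ℝ) ^ m = Real.exp (-(m * Real.log 2)) := by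
  rw [Real.exp_neg, ← Real.log_pow, Real.exp_log (by positivity), one_div, inv_pow]

theorem rpow_log_div_log {x y : ℝ} (hx : 1 < x) (hy : 0 < y) :
    x ^ (Real.log y / Real.log x) = y := by
  rw [Real.rpow_def_of_pos (by linarith), mul_div_cancel₀ _ (Real.log_pos hx).ne',
    Real.exp_log hy]

theorem tendsto_log_natCast_atTop : Tendsto (fun n : ℕ => Real.log n) atTop atTop :=
  Real.tendsto_log_atTop.comp tendsto_natCast_atTop_atTop

theorem tendsto_log_pow_div_rpow (k : ℕ) {s : ℝ} (hs : 0 < s) :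
    Tendsto (fun n : ℕ => Real.log n ^ k / (n : ℝ) ^ s) atTop (𝓝 0) := by
  have h := (isLittleO_log_rpow_rpow_atTop (k : ℝ) hs).tendsto_div_nhds_zero
  simpa only [Function.comp_def, Real.rpow_natCast] using h.comp tendsto_natCast_atTop_atTop

variable {n d : ℕ} [NeZero n]

theorem corrError_le (hlog : 1 ≤ Real.log n) :
    corrError n d ≤ d ^ 3 * spreadConst d ^ 2 / 2 * (3 * Real.log n / n) := by
  have h := one_div_totient_le (NeZero.ne n) hlog
  have e : corrError n d = d ^ 3 * spreadConst d ^ 2 / 2 * (1 / n.totient) := by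
    rw [corrError]
    ring
  rw [e]
  exact mul_le_mul_of_nonneg_left h (by positivity)

theorem mul_tailProb_ceil_le (hd : 3 ≤ d) (hlog : 1 ≤ Real.log n)
    (he : corrError n d ≤ 1 / 4) :
    n * tailProb n d (⌈Real.log (Real.log n) / Real.log d⌉₊ + 4) n
      ≤ (1 + 3 * (d ^ 3 * spreadConst d ^ 2)) * Real.log n := by
  have hn0 : (0 : ℝ) < n := Nat.cast_pos.2 (Nat.pos_of_ne_zero (NeZero.ne n))
  have hd1 : (1 : ℝ) < d := by exact_mod_cast (by omega : 1 < d)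
  have hd3 : (3 : ℝ) ≤ d := by exact_mod_cast hd
  set k := ⌈Real.log (Real.log n) / Real.log d⌉₊ with hk
  have h1 : Real.log n ≤ (d : ℝ) ^ k := by
    rw [← rpow_log_div_log hd1 (by linarith : 0 < Real.log n), ← Real.rpow_natCast]
    exact Real.rpow_le_rpow_of_exponent_le hd1.le (Nat.le_ceil _)
  -- d^k ≥ log n, and one extra level supplies the factor d ≥ 3 > 1/log 2. With the offset 3 of
  -- `tailProb_add_three_le` this makes k + 4.
  have h2 : (1 / 2 : ℝ) ^ d ^ (k + 1) ≤ 1 / n := by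
    have h3 : (1 : ℝ) / n = Real.exp (-Real.log n) := by
      rw [Real.exp_neg, Real.exp_log hn0, one_div]
    rw [half_pow_eq_exp, h3]
    refine Real.exp_le_exp.2 (neg_le_neg ?_)
    push_cast
    have h4 : 3 * Real.log n ≤ (d : ℝ) ^ (k + 1) := by
      rw [pow_succ']
      exact mul_le_mul hd3 h1 (by linarith) (by linarith)
    have h5 := mul_le_mul h4 (by linarith [Real.log_two_gt_d9] : 1 / 2 ≤ Real.log 2)
      (by norm_num) (by positivity)
    linarith
  have h6 := tailProb_add_three_le hd he (k + 1)
  have h7 : n * corrError n d ≤ d ^ 3 * spreadConst d ^ 2 / 2 * (3 * Real.log n) := by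
    refine (mul_le_mul_of_nonneg_left (corrError_le hlog) hn0.le).trans_eq ?_
    field_simp
  have h8 : 0 ≤ (d : ℝ) ^ 3 * spreadConst d ^ 2 * Real.log n :=
    mul_nonneg (by positivity) (by linarith)
  rcases le_max_iff.1 h6 with h | h
  · have h9 : n * tailProb n d (k + 4) n ≤ n * (1 / n) :=
      mul_le_mul_of_nonneg_left (h.trans (by
        have : (0 : ℝ) ≤ (1 / 2) ^ d ^ (k + 1) := by positivity
        linarith)) hn0.le
    rw [mul_one_div_cancel hn0.ne'] at h9
    linarith
  · have h9 : n * tailProb n d (k + 4) n ≤ n * (2 * corrError n d) :=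
      mul_le_mul_of_nonneg_left h hn0.le
    linarith

theorem le_tailProb_floor (hd : 3 ≤ d) (hlog : 1 ≤ Real.log n)
    (hfloor : 3 ≤ ⌊Real.log (Real.log n) / Real.log d⌋₊)
    (he : 8 * corrError n d ≤ Real.exp (-(Real.log n / 4))) :
    Real.exp (-(Real.log n / 4))
      ≤ tailProb n d (⌊Real.log (Real.log n) / Real.log d⌋₊ - 3) n := by
  have hn0 : (0 : ℝ) < n := Nat.cast_pos.2 (Nat.pos_of_ne_zero (NeZero.ne n))
  have hd1 : (1 : ℝ) < d := by exact_mod_cast (by omega : 1 < d)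
  have hd3 : (3 : ℝ) ≤ d := by exact_mod_cast hd
  obtain ⟨k, hk⟩ := Nat.exists_eq_add_of_le' hfloor
  rw [hk, Nat.add_sub_cancel]
  have hdk : 0 ≤ (d : ℝ) ^ k := by positivity
  -- Three levels are given up because d³ ≥ 27 ≥ 6 · 4: the exponent 6 d^k then stays below (log
  -- n)/4.
  have h1 : 27 * (d : ℝ) ^ k ≤ Real.log n := by
    calc 27 * (d : ℝ) ^ k = 3 ^ 3 * d ^ k := by norm_num
      _ ≤ (d : ℝ) ^ 3 * d ^ k := by gcongr
      _ = (d : ℝ) ^ ((k + 3 : ℕ) : ℝ) := by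
          rw [Real.rpow_natCast]
          ring
      _ ≤ (d : ℝ) ^ (Real.log (Real.log n) / Real.log d) := by
          refine Real.rpow_le_rpow_of_exponent_le hd1.le ?_
          rw [← hk]
          exact Nat.floor_le (Nat.pos_of_floor_pos (by omega)).le
      _ = Real.log n := rpow_log_div_log hd1 (by linarith)
  have h2 : Real.exp (-(Real.log n / 4)) ≤ (1 / 2) ^ (6 * d ^ k) := by
    rw [half_pow_eq_exp]
    refine Real.exp_le_exp.2 (neg_le_neg ?_)
    push_cast
    have := mul_le_mul_of_nonneg_left (by linarith [Real.log_two_lt_d9] : Real.log 2 ≤ 1) hdk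
    linarith
  have h3 : 2 ^ k ≤ n := by
    have h4 : (2 : ℝ) ^ k ≤ n := by
      calc (2 : ℝ) ^ k ≤ (d : ℝ) ^ k := pow_le_pow_left₀ (by norm_num) (by linarith) k
        _ ≤ Real.log n := by linarith
        _ ≤ n := (Real.log_le_sub_one_of_pos hn0).trans (by linarith)
    exact_mod_cast h4
  refine h2.trans (le_trans ?_ ((pow_lowerExponent_le_tailProb hd k (he.trans h2) h3).trans
    (tailProb_monotone k (Nat.sub_le _ _))))
  exact pow_le_pow_of_le_one (by norm_num) (by norm_num)
    (by have := lowerExponent_add_le hd k; omega)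

/-- A bound for the probability that the maximum load is far from its typical value. -/
noncomputable def failBound (d n : ℕ) : ℝ :=
  3 * (Real.log n ^ 5 / (n : ℝ) ^ (1 : ℝ)) + (1 + 3 * (d ^ 3 * spreadConst d ^ 2)) / Real.log n
    + spreadConst d ^ 2 / 2 * (Real.log n ^ 0 / (n : ℝ) ^ (1 / 2 : ℝ))

/-- The exponents 0 and 1 in `failBound` fit its terms to `tendsto_log_pow_div_rpow`. -/
theorem tendsto_failBound (d : ℕ) : Tendsto (failBound d) atTop (𝓝 0) := by
  have h1 := (tendsto_log_pow_div_rpow 5 one_pos).const_mul 3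
  have h2 := tendsto_log_natCast_atTop.const_div_atTop (1 + 3 * (d ^ 3 * spreadConst d ^ 2))
  have h3 := (tendsto_log_pow_div_rpow 0 (by norm_num : (0 : ℝ) < 1 / 2)).const_mul
    (spreadConst d ^ 2 / 2)
  have h := (h1.add h2).add h3
  simp only [mul_zero, add_zero] at h
  exact h

theorem one_sub_failBound_le (hd : 3 ≤ d) (hlog : 1 ≤ Real.log n)
    (hfloor : 3 ≤ ⌊Real.log (Real.log n) / Real.log d⌋₊)
    (he : 8 * corrError n d ≤ Real.exp (-(Real.log n / 4))) :
    ENNReal.ofReal (1 - failBound d n) ≤ ballsLaw n d n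
      {ω | |(maxLoad ω : ℝ) - Real.log (Real.log n) / Real.log d| ≤ 5} := by
  classical
  have hn0 : (0 : ℝ) < n := Nat.cast_pos.2 (Nat.pos_of_ne_zero (NeZero.ne n))
  have hlog0 : 0 < Real.log n := by linarith
  have he4 : corrError n d ≤ 1 / 4 := by
    have : Real.exp (-(Real.log n / 4)) ≤ 1 := Real.exp_le_one_iff.2 (by linarith)
    linarith
  have hup := mul_tailProb_ceil_le hd hlog he4
  have hlow := le_tailProb_floor hd hlog hfloor he
  set t := Real.log (Real.log n) / Real.log d with ht
  have ht0 : 0 < t := Nat.pos_of_floor_pos (by omega)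
  rw [ballsLaw_eq_ofReal]
  -- The threshold l = (log n)² lies between the mean count O_d(log n) and the order √φ(n) at which
  -- l²/φ(n) stops being small.
  refine ENNReal.ofReal_le_ofReal (le_trans ?_ (one_sub_le_expect_maxLoad (by omega)
    (pow_pos hlog0 2) ((Real.exp_pos _).trans_le hlow) _ (j := ⌈t⌉₊ + 4) fun ω h1 h2 => ?_))
  · refine sub_le_sub_left ?_ 1
    rw [failBound]
    refine add_le_add (add_le_add ?_ ?_) ?_
    · calc (Real.log n ^ 2) ^ 2 / n.totient = Real.log n ^ 4 * (1 / n.totient) := by ring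
        _ ≤ Real.log n ^ 4 * (3 * Real.log n / n) :=
            mul_le_mul_of_nonneg_left (one_div_totient_le (NeZero.ne n) hlog) (by positivity)
        _ = 3 * (Real.log n ^ 5 / (n : ℝ) ^ (1 : ℝ)) := by
            rw [Real.rpow_one]
            ring
    · rw [div_le_div_iff₀ (by positivity) hlog0]
      calc _ ≤ (1 + 3 * (d ^ 3 * spreadConst d ^ 2)) * Real.log n * Real.log n :=
            mul_le_mul_of_nonneg_right hup hlog0.le
        _ = _ := by ring
    · have h1 : (n : ℝ) ^ (1 / 2 : ℝ) ≤ n * tailProb n d (⌊t⌋₊ - 3) n ^ 2 := by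
        calc (n : ℝ) ^ (1 / 2 : ℝ) = n * Real.exp (-(Real.log n / 4)) ^ 2 := by
              nth_rewrite 2 [← Real.exp_log hn0]
              rw [← Real.exp_nat_mul, ← Real.exp_add, Real.rpow_def_of_pos hn0]
              congr 1
              push_cast
              ring
          _ ≤ _ := by gcongr
      rw [pow_zero, mul_one_div, div_div]
      gcongr
  · have h3 : t < ⌊t⌋₊ + 1 := Nat.lt_floor_add_one t
    have h4 : (⌈t⌉₊ : ℝ) < t + 1 := Nat.ceil_lt_add_one ht0.le
    have h5 : (⌊t⌋₊ : ℝ) ≤ maxLoad ω + 3 := by exact_mod_cast (by omega : ⌊t⌋₊ ≤ maxLoad ω + 3)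
    have h6 : (maxLoad ω : ℝ) ≤ ⌈t⌉₊ + 4 := by exact_mod_cast h2
    change |(maxLoad ω : ℝ) - t| ≤ 5
    exact abs_le.2 ⟨by linarith, by linarith⟩

theorem ballsLaw_le_one {n d : ℕ} (hn : n ≠ 0) (S : Set (Fin n → BallData n d)) : ballsLaw n d n S ≤ 1 := by
  classical
  have : NeZero n := ⟨hn⟩
  rw [ballsLaw_eq_ofReal]
  refine ENNReal.ofReal_le_one.2 (Finset.expect_le Finset.univ_nonempty fun ω _ => ?_)
  split_ifs <;> norm_num

theorem eventually_corrError_le (c : ℝ) :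
    ∀ᶠ n : ℕ in atTop, 8 * (c * (3 * Real.log n / n)) ≤ Real.exp (-(Real.log n / 4)) := by
  have h := (tendsto_log_pow_div_rpow 1 (by norm_num : (0 : ℝ) < 3 / 4)).const_mul (24 * c)
  rw [mul_zero] at h
  filter_upwards [h.eventually_le_const one_pos, eventually_gt_atTop 0] with n hn hn0
  have hn0 : (0 : ℝ) < n := Nat.cast_pos.2 hn0
  have e1 : (n : ℝ) ^ (3 / 4 : ℝ) * Real.exp (Real.log n / 4) = n := by
    rw [Real.rpow_def_of_pos hn0, ← Real.exp_add]
    conv_rhs => rw [← Real.exp_log hn0]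
    congr 1
    ring
  have e2 : 8 * (c * (3 * Real.log n / n))
      = 24 * c * (Real.log n ^ 1 / (n : ℝ) ^ (3 / 4 : ℝ)) * Real.exp (-(Real.log n / 4)) := by
    nth_rewrite 2 [← e1]
    rw [Real.exp_neg]
    field_simp
    ring
  rw [e2]
  exact mul_le_of_le_one_left (Real.exp_pos _).le hn

end Asymptotics

theorem mainTheorem5 :
    ∃ C : ℝ, ∀ d : ℕ, 3 ≤ d →
      Tendsto
        (fun n : ℕ => ballsLaw n d n
          {ω | |(maxLoad ω : ℝ) - Real.log (Real.log n) / Real.log d| ≤ C})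
        atTop (𝓝 1) := by
  -- With t = log log n / log d, the load lies between ⌊t⌋ - 3 > t - 4 and ⌈t⌉ + 4 < t + 5.
  refine ⟨5, fun d hd => ?_⟩
  have hd1 : (1 : ℝ) < d := by exact_mod_cast (by omega : 1 < d)
  have hlower : Tendsto (fun n => ENNReal.ofReal (1 - failBound d n)) atTop (𝓝 1) := by
    have h := ENNReal.tendsto_ofReal ((tendsto_failBound d).const_sub 1)
    rwa [sub_zero, ENNReal.ofReal_one] at h
  have hfloor : Tendsto (fun n : ℕ => ⌊Real.log (Real.log n) / Real.log d⌋₊) atTop atTop :=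
    tendsto_nat_floor_atTop.comp
      ((Real.tendsto_log_atTop.comp tendsto_log_natCast_atTop).atTop_div_const (Real.log_pos hd1))
  refine tendsto_of_tendsto_of_tendsto_of_le_of_le' hlower tendsto_const_nhds ?_ ?_
  · filter_upwards [eventually_gt_atTop 0, tendsto_log_natCast_atTop.eventually_ge_atTop 1,
      hfloor.eventually_ge_atTop 3, eventually_corrError_le (d ^ 3 * spreadConst d ^ 2 / 2)]
      with n hn hlog hfl he
    have : NeZero n := ⟨hn.ne'⟩
    refine one_sub_failBound_le hd hlog hfl (le_trans ?_ he)
    exact mul_le_mul_of_nonneg_left (corrError_le hlog) (by norm_num)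
  · filter_upwards [eventually_gt_atTop 0] with n hn
    exact ballsLaw_le_one hn.ne' _
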